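/- Let $N\ge 1$ be an integer. For $a\in\mathbb{R}$ and $x>0$ let $I_a(x)=\sum_{k\ge 0}\frac{1}{k!\,\Gamma(a+k+1)}\left(\frac{x}{2}\right)^{2k+a}$ be the modified Bessel function of the first kind (with $1/\Gamma=0$ at the poles of $\Gamma$). For $t>0$ and $n=(n_1,\dots,n_N)\in\mathbb{Z}^N$ put $$G_{t,N}(n)=\prod_{i=1}^{N}e^{-2t}I_{n_i}(2t),\qquad W_tf(n)=\sum_{k\in\mathbb{Z}^N}G_{t,N}(n-k)f(k),\qquad |n|=|n_1|+\cdots+|n_N|,$$ so that $G_{t,N}$ is the heat kernel and $W_t$ the heat semigroup of the discrete Laplacian on $\mathbb{Z}^N$. Let $1\le q\le p\le\infty$ with $q<N/(N-1)$ (that is, $q<\infty$ if $N=1$). Then there is a constant $C>0$, depending only on $N$, $p$ and $q$, such that for every $f:\mathbb{Z}^N\to\mathbb{C}$ with $|\cdot|f\in\ell^q(\mathbb{Z}^N)$ the following holds: $f$ is summable, and for every $t>0$ the series defining $W_tf(n)$ converges absolutely for all $n$ and $$\left\|W_tf-\Big(\sum_{k\in\mathbb{Z}^N}f(k)\Big)G_{t,N}\right\|_{\ell^p(\mathbb{Z}^N)}\le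 C\,t^{-\frac12-\frac N2\left(\frac1q-\frac1p\right)}\,\big\||\cdot|f\big\|_{\ell^q(\mathbb{Z}^N)}.$$ -/

import Mathlib

open MeasureTheory
open scoped ENNReal Nat

noncomputable section

/-- The modified Bessel function of the first kind of order `a`,
`I_a(x) = ∑_k (x / 2) ^ (2k + a) / (k! Γ(a + k + 1))`, for `x > 0`.
`Real.Gamma` vanishes at its poles `0, -1, -2, …`, hence `(Real.Gamma y)⁻¹` is the entire
reciprocal Gamma function for every real `y`. -/
def besselI (a x : ℝ) : ℝ :=
  ∑' k : ℕ, (Real.Gamma (a + k + 1))⁻¹ / (k ! : ℝ) * (x / 2) ^ (2 * (k : ℝ) + a)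

/-- The heat kernel on `ℤ^N`: `G_{t,N}(n) = ∏_i e^{-2t} I_{n_i}(2t)`. -/
def heatKernel {N : ℕ} (t : ℝ) (n : Fin N → ℤ) : ℝ :=
  ∏ i, Real.exp (-2 * t) * besselI (n i) (2 * t)

/-- The discrete heat semigroup: `W_t f(n) = ∑_{k ∈ ℤ^N} G_{t,N}(n - k) f(k)`. -/
def heatSemigroup {N : ℕ} (t : ℝ) (f : (Fin N → ℤ) → ℂ) (n : Fin N → ℤ) : ℂ :=
  ∑' k : Fin N → ℤ, (heatKernel t (n - k) : ℂ) * f k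

/-- The length `|n| = |n_1| + ⋯ + |n_N|` of a lattice point. -/
def latticeAbs {N : ℕ} (n : Fin N → ℤ) : ℝ :=
  ∑ i, |(n i : ℝ)|

/-- The `ℓ^p(ℤ^N)` norm, `1 ≤ p ≤ ∞`, with values in `[0, ∞]`: it is the `L^p` norm for the
counting measure. -/
def ellNorm {N : ℕ} (p : ℝ≥0∞) (f : (Fin N → ℤ) → ℂ) : ℝ≥0∞ :=
  eLpNorm f p Measure.count

end

/-! Since `W_t f(n) - (∑ f) G(n) = ∑_k (G(n-k) - G(n)) f(k)`, everything rests on a first-order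
estimate of the kernel increment. The one used, in `exists_abs_heatKernel_sub_le`, is `|G(n-k) -
G(n)| ≤ 2 (|k|/√t) (G(n-k) + Ψ(n) v(|k|))`, with `v(x) = √t/(√t+|x|)`, where `Ψ` has bounded mass
and height `O(t^{-N/2})`, like the kernel itself. For `|k| ≥ √t` it is the triangle inequality; for
`|k| ≤ √t` it is a gradient bound.

The factor `|k|` is absorbed into `g = |·|f`. The term `G(n-k)` gives a convolution, controlled in
`ℓ^q` and `ℓ^∞` by Jensen's inequality. The other term separates as `Ψ(n) ∑_k |g(k)| v(|k|)`; Hölder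
bounds the sum by `t^{(N/2)(1-1/q)} ‖g‖_q`. For `q > 1` this needs `v(|·|)` in `ℓ^{q'}`, supplied by
`q' > N`, that is `q < N/(N-1)`. The growth in `t` is cancelled by the size of `Ψ` in `ℓ^q`, and
`ℓ^p` follows by interpolation.

The gradient bound is one-dimensional. The generating function `exp(t(z + 1/z))` yields a Fourier
integral, so an `m`-th difference of the kernel is `O(t^{-(m+1)/2})`. The recurrence `n G(n) = t
(G(n-1) - G(n+1))` trades powers of `n` for differences, turning these uniform bounds into quadratic
spatial decay. -/

noncomputable section

/-! ### Integer-order Bessel functions: generating function and recurrence. -/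

/-- The coefficients `t ^ k / k!`, extended by `0` to negative `k`. -/
def expCoeff (t : ℝ) (k : ℤ) : ℝ := if 0 ≤ k then t ^ k.toNat / (k.toNat ! : ℝ) else 0

lemma expCoeff_natCast (t : ℝ) (k : ℕ) : expCoeff t k = t ^ k / (k ! : ℝ) := by
  simp [expCoeff]

lemma expCoeff_of_neg (t : ℝ) {k : ℤ} (hk : k < 0) : expCoeff t k = 0 := by
  simp [expCoeff, hk]

lemma expCoeff_nonneg {t : ℝ} (ht : 0 ≤ t) (k : ℤ) : 0 ≤ expCoeff t k := by
  unfold expCoeff; split_ifs <;> positivity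

lemma mul_expCoeff (t : ℝ) (k : ℤ) : (k : ℝ) * expCoeff t k = t * expCoeff t (k - 1) := by
  rcases lt_trichotomy k 0 with hk | rfl | hk
  · rw [expCoeff_of_neg t hk, expCoeff_of_neg t (by lia)]; simp
  · rw [expCoeff_of_neg t (k := 0 - 1) (by lia)]; simp
  · obtain ⟨m, rfl⟩ : ∃ m : ℕ, k = (m : ℤ) + 1 := ⟨(k - 1).toNat, by lia⟩
    have h1 : expCoeff t ((m : ℤ) + 1) = t ^ (m + 1) / ((m + 1)! : ℝ) := by
      rw [← expCoeff_natCast]; simp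
    rw [h1, add_sub_cancel_right, expCoeff_natCast, Nat.factorial_succ]
    push_cast
    field_simp
    ring

lemma hasSum_expCoeff_mul_zpow (t : ℝ) (z : ℂ) :
    HasSum (fun k : ℤ => (expCoeff t k : ℂ) * z ^ k) (Complex.exp (t * z)) := by
  rw [← Function.Injective.hasSum_iff (Nat.cast_injective (R := ℤ))]
  · have h := NormedSpace.expSeries_div_hasSum_exp ((t : ℂ) * z)
    rw [← Complex.exp_eq_exp_ℂ] at h
    refine h.congr_fun ?_
    intro k
    simp [expCoeff_natCast, mul_pow]; ring
  · intro k hk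
    rw [expCoeff_of_neg]
    · simp
    · by_contra! h
      exact hk ⟨k.toNat, by simp [h]⟩

lemma hasSum_expCoeff (t : ℝ) : HasSum (expCoeff t) (Real.exp t) := by
  have h := hasSum_expCoeff_mul_zpow t 1
  simp only [one_zpow, mul_one] at h
  exact_mod_cast h

/-- The Bessel function `I_n(2t)` of integer order as an autocorrelation. -/
def besselCorr (t : ℝ) (n : ℤ) : ℝ := ∑' k : ℤ, expCoeff t k * expCoeff t (k + n)

lemma summable_expCoeff_mul {t : ℝ} (ht : 0 ≤ t) :
    Summable fun p : ℤ × ℤ => expCoeff t p.1 * expCoeff t p.2 := by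
  have h := (hasSum_expCoeff t).summable
  exact h.mul_of_nonneg h (expCoeff_nonneg ht) (expCoeff_nonneg ht)

/-- The change of variables `(n, k) ↦ (k, k + n)`. -/
def lagEquiv : ℤ × ℤ ≃ ℤ × ℤ where
  toFun p := (p.2, p.2 + p.1)
  invFun p := (p.2 - p.1, p.1)
  left_inv p := by simp
  right_inv p := by simp

lemma summable_expCoeff_lag {t : ℝ} (ht : 0 ≤ t) :
    Summable fun p : ℤ × ℤ => expCoeff t p.2 * expCoeff t (p.2 + p.1) :=
  (lagEquiv.summable_iff (f := fun p : ℤ × ℤ => expCoeff t p.1 * expCoeff t p.2)).2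
    (summable_expCoeff_mul ht)

lemma summable_besselCorr_term {t : ℝ} (ht : 0 ≤ t) (n : ℤ) :
    Summable fun k : ℤ => expCoeff t k * expCoeff t (k + n) :=
  (summable_expCoeff_lag ht).prod_factor n

lemma besselCorr_nonneg {t : ℝ} (ht : 0 ≤ t) (n : ℤ) : 0 ≤ besselCorr t n :=
  tsum_nonneg fun _ => mul_nonneg (expCoeff_nonneg ht _) (expCoeff_nonneg ht _)

/-- Multiply the series of `exp(t/z)` and `exp(tz)` and group the terms by the difference of the two
indices. -/
lemma hasSum_besselCorr_mul_zpow {t : ℝ} (ht : 0 ≤ t) {z : ℂ} (hz : ‖z‖ = 1) :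
    HasSum (fun n : ℤ => (besselCorr t n : ℂ) * z ^ n) (Complex.exp (t * (z⁻¹ + z))) := by
  have hz0 : z ≠ 0 := by rintro rfl; simp at hz
  have hs : Summable fun p : ℤ × ℤ =>
      ((expCoeff t p.1 : ℂ) * z⁻¹ ^ p.1) * ((expCoeff t p.2 : ℂ) * z ^ p.2) := by
    apply Summable.of_norm
    refine (summable_expCoeff_mul ht).congr fun p => ?_
    simp [hz, abs_of_nonneg (expCoeff_nonneg ht _)]
  have h := (hasSum_expCoeff_mul_zpow t z⁻¹).mul (hasSum_expCoeff_mul_zpow t z) hs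
  rw [← Complex.exp_add, ← mul_add, ← lagEquiv.hasSum_iff] at h
  refine h.prod_fiberwise fun n => ?_
  have h2 := ((Complex.hasSum_ofReal.2 (summable_besselCorr_term ht n).hasSum)).mul_right (z ^ n)
  refine h2.congr_fun ?_
  intro k
  simp only [lagEquiv, Equiv.coe_fn_mk, Function.comp_apply, zpow_add₀ hz0, inv_zpow]
  have : z ^ k ≠ 0 := zpow_ne_zero _ hz0
  push_cast
  field_simp

lemma hasSum_besselCorr {t : ℝ} (ht : 0 ≤ t) :
    HasSum (besselCorr t) (Real.exp (2 * t)) := by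
  have h := hasSum_besselCorr_mul_zpow ht (z := 1) (by simp)
  simp only [one_zpow, mul_one, inv_one] at h
  rw [show (t : ℂ) * (1 + 1) = ((2 * t : ℝ) : ℂ) by push_cast; ring] at h
  exact_mod_cast h

/-- Write `n = (k + n) - k` inside the autocorrelation; each factor lowers the index of one
coefficient through `mul_expCoeff`. -/
lemma int_mul_besselCorr {t : ℝ} (ht : 0 ≤ t) (n : ℤ) :
    (n : ℝ) * besselCorr t n = t * (besselCorr t (n - 1) - besselCorr t (n + 1)) := by
  have h1 := ((summable_besselCorr_term ht (n - 1)).hasSum.mul_left t)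
  have h2 := ((summable_besselCorr_term ht (n + 1)).hasSum.mul_left t)
  have h3 : HasSum (fun k : ℤ => t * (expCoeff t (k - 1) * expCoeff t (k - 1 + (n + 1))))
      (t * besselCorr t (n + 1)) := (Equiv.subRight (1 : ℤ)).hasSum_iff.2 h2
  have h4 := h1.sub h3
  rw [mul_sub]
  refine HasSum.unique ?_ h4
  refine ((summable_besselCorr_term ht n).hasSum.mul_left (n : ℝ)).congr_fun ?_
  intro k
  have e1 := mul_expCoeff t (k + n)
  have e2 := mul_expCoeff t k
  rw [show k + n - 1 = k + (n - 1) by ring] at e1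
  rw [show k - 1 + (n + 1) = k + n by ring]
  push_cast at e1
  linear_combination (-expCoeff t k) * e1 + expCoeff t (k + n) * e2

lemma besselI_intCast {t : ℝ} (ht : 0 < t) (n : ℤ) : besselI n (2 * t) = besselCorr t n := by
  unfold besselI besselCorr
  rw [← Function.Injective.tsum_eq (Nat.cast_injective (R := ℤ))]
  · congr 1
    ext k
    rw [expCoeff_natCast, mul_div_cancel_left₀ _ (two_ne_zero)]
    rcases lt_or_ge ((k : ℤ) + n) 0 with h | h
    · rw [expCoeff_of_neg t h]
      -- The Gamma argument is a pole here, so the term vanishes, matching the extension of the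
      -- coefficients by zero.
      obtain ⟨m, hm⟩ : ∃ m : ℕ, (k : ℤ) + n = -(m : ℤ) - 1 := ⟨(-(k + n) - 1).toNat, by lia⟩
      have : (n : ℝ) + k + 1 = -(m : ℝ) := by
        have : ((k + n : ℤ) : ℝ) = ((-(m : ℤ) - 1 : ℤ) : ℝ) := by rw [hm]
        push_cast at this
        linarith
      rw [this, Real.Gamma_neg_nat_eq_zero]
      simp
    · obtain ⟨m, hm⟩ := Int.eq_ofNat_of_zero_le h
      have hr : (k : ℝ) + n = m := by exact_mod_cast hm
      rw [hm, expCoeff_natCast, show (n : ℝ) + k + 1 = m + 1 by linarith,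
        Real.Gamma_nat_eq_factorial, show 2 * (k : ℝ) + n = k + m by linarith,
        Real.rpow_add ht, Real.rpow_natCast, Real.rpow_natCast]
      field_simp
  · intro k hk
    by_contra h
    refine hk ?_
    dsimp only
    rw [expCoeff_of_neg]
    · simp
    · by_contra! h'
      exact h ⟨k.toNat, by simp [h']⟩

/-! ### Fourier integral representation. -/

lemma integral_cexp_int_mul (n : ℤ) :
    ∫ θ in (-Real.pi)..Real.pi, Complex.exp (n * (θ * Complex.I)) =
      if n = 0 then 2 * (Real.pi : ℂ) else 0 := by
  split_ifs with hn
  · subst hn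
    simp
    ring
  · have hc : (n : ℂ) * Complex.I ≠ 0 := by simp [hn]
    have h := integral_exp_mul_complex (a := -Real.pi) (b := Real.pi) hc
    have e : (n : ℂ) * Complex.I * (Real.pi : ℝ) =
        (n : ℂ) * Complex.I * ((-Real.pi : ℝ) : ℂ) + n * (2 * Real.pi * Complex.I) := by
      push_cast; ring
    rw [e, Complex.exp_add, Complex.exp_int_mul_two_pi_mul_I, mul_one, sub_self, zero_div] at h
    rw [← h]
    congr 1
    ext θ
    congr 1
    ring

lemma two_pi_mul_besselCorr {t : ℝ} (ht : 0 ≤ t) (m : ℤ) :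
    2 * (Real.pi : ℂ) * besselCorr t m = ∫ θ in (-Real.pi)..Real.pi,
      Complex.exp (2 * t * Real.cos θ) * Complex.exp (-m * (θ * Complex.I)) := by
  have key := intervalIntegral.hasSum_integral_of_dominated_convergence
    (a := -Real.pi) (b := Real.pi) (μ := volume) (ι := ℤ)
    (F := fun n θ => (besselCorr t n : ℂ) * Complex.exp (((n - m : ℤ) : ℂ) * (θ * Complex.I)))
    (f := fun θ : ℝ =>
      Complex.exp (2 * t * Real.cos θ) * Complex.exp (-m * (θ * Complex.I)))
    (fun n _ => besselCorr t n)
    (fun n => (by fun_prop : Continuous _).aestronglyMeasurable)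
    (fun n => Filter.Eventually.of_forall fun θ _ => by
      rw [norm_mul, show ((n - m : ℤ) : ℂ) * (θ * Complex.I) =
        (((n - m : ℤ) * θ : ℝ) : ℂ) * Complex.I by push_cast; ring,
        Complex.norm_exp_ofReal_mul_I, Complex.norm_real,
        Real.norm_of_nonneg (besselCorr_nonneg ht n), mul_one])
    (Filter.Eventually.of_forall fun θ _ => (hasSum_besselCorr ht).summable)
    (by simp)
    (Filter.Eventually.of_forall fun θ _ => by
      have h := (hasSum_besselCorr_mul_zpow ht (Complex.norm_exp_ofReal_mul_I θ)).mul_right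
        (Complex.exp (-m * (θ * Complex.I)))
      have e : (t : ℂ) * ((Complex.exp (θ * Complex.I))⁻¹ + Complex.exp (θ * Complex.I)) =
          2 * t * Real.cos θ := by
        rw [Complex.ofReal_cos, mul_right_comm, Complex.two_cos, neg_mul, Complex.exp_neg]
        ring
      rw [e] at h
      refine h.congr_fun fun n => ?_
      rw [← Complex.exp_int_mul, mul_assoc, ← Complex.exp_add]
      congr 2
      push_cast
      ring)
  have h := key.unique (hasSum_single m fun n hn => ?_)
  · rw [h, intervalIntegral.integral_const_mul, integral_cexp_int_mul]
    simp
    ring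
  · rw [intervalIntegral.integral_const_mul, integral_cexp_int_mul, if_neg (sub_ne_zero.2 hn),
      mul_zero]

/-! ### The one-dimensional heat kernel and uniform bounds for its differences. -/

/-- The one-dimensional heat kernel `e^{-2t} I_n(2t)`. -/
def heatKernelOne (t : ℝ) (n : ℤ) : ℝ := Real.exp (-2 * t) * besselCorr t n

lemma heatKernel_eq_prod {N : ℕ} {t : ℝ} (ht : 0 < t) (n : Fin N → ℤ) :
    heatKernel t n = ∏ i, heatKernelOne t (n i) := by
  simp only [heatKernel, heatKernelOne, besselI_intCast ht]

lemma heatKernelOne_nonneg {t : ℝ} (ht : 0 ≤ t) (n : ℤ) : 0 ≤ heatKernelOne t n :=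
  mul_nonneg (Real.exp_nonneg _) (besselCorr_nonneg ht n)

lemma hasSum_heatKernelOne {t : ℝ} (ht : 0 ≤ t) : HasSum (heatKernelOne t) 1 := by
  have h := (hasSum_besselCorr ht).mul_left (Real.exp (-2 * t))
  rwa [← Real.exp_add, show -2 * t + 2 * t = 0 by ring, Real.exp_zero] at h

lemma int_mul_heatKernelOne {t : ℝ} (ht : 0 ≤ t) (n : ℤ) :
    (n : ℝ) * heatKernelOne t n = t * (heatKernelOne t (n - 1) - heatKernelOne t (n + 1)) := by
  unfold heatKernelOne
  linear_combination Real.exp (-2 * t) * int_mul_besselCorr ht n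

lemma two_pi_mul_heatKernelOne {t : ℝ} (ht : 0 ≤ t) (m : ℤ) :
    2 * (Real.pi : ℂ) * heatKernelOne t m = ∫ θ in (-Real.pi)..Real.pi,
      ((Real.exp (-2 * t * (1 - Real.cos θ)) : ℝ) : ℂ) *
        Complex.exp (-m * (θ * Complex.I)) := by
  have h := congrArg (fun z => ((Real.exp (-2 * t) : ℝ) : ℂ) * z) (two_pi_mul_besselCorr ht m)
  simp only [← intervalIntegral.integral_const_mul] at h
  rw [heatKernelOne]
  push_cast at h ⊢
  rw [mul_left_comm, h]
  congr 1
  ext θ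
  rw [← mul_assoc, ← Complex.exp_add]
  congr 2
  ring

/-- A combination of translates is the Fourier integral of `exp(-2t(1 - cos θ))` times a
trigonometric polynomial. As `1 - cos θ ≥ 2θ²/π²` on `[-π, π]`, a polynomial of size `K|θ|^m` leaves
a Gaussian moment, whence the power of `t`. -/
lemma exists_abs_sum_heatKernelOne_le (m : ℕ) : ∃ C : ℝ, 0 < C ∧
    ∀ {ι : Type} [Fintype ι] (c : ι → ℝ) (j : ι → ℤ) (K : ℝ),
      (∀ θ : ℝ, ‖∑ i, (c i : ℂ) * Complex.exp (-(j i) * (θ * Complex.I))‖ ≤ K * |θ| ^ m) →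
      ∀ t : ℝ, 0 < t → ∀ n : ℤ,
        |∑ i, c i * heatKernelOne t (n + j i)| ≤ K * C * t ^ (-((m : ℝ) + 1) / 2) := by
  set D : ℝ := 2 * ((4 / Real.pi ^ 2) ^ (-((m : ℝ) + 1) / 2) * (1 / 2) *
    Real.Gamma (((m : ℝ) + 1) / 2)) with hD
  have hpi := Real.pi_pos
  have hD0 : 0 < D := by
    have : 0 < Real.Gamma (((m : ℝ) + 1) / 2) := Real.Gamma_pos_of_pos (by positivity)
    positivity
  refine ⟨D / (2 * Real.pi), by positivity, ?_⟩
  intro ι _ c j K hP t ht n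
  set b : ℝ := 4 / Real.pi ^ 2 * t with hb
  have hb0 : 0 < b := by positivity
  set ψ : ℝ → ℝ := fun θ => |θ| ^ (m : ℝ) * Real.exp (-b * |θ| ^ (2 : ℝ)) with hψ
  have hint : Integrable ψ := by
    have h := (integrable_rpow_mul_exp_neg_mul_sq hb0 (s := m)
      (by have : (0 : ℝ) ≤ m := by positivity
          linarith)).norm
    refine h.congr (Filter.Eventually.of_forall fun θ => ?_)
    simp [hψ]
  have hval : ∫ θ, ψ θ = D * t ^ (-((m : ℝ) + 1) / 2) := by
    rw [hψ, integral_comp_abs (f := fun θ => θ ^ (m : ℝ) * Real.exp (-b * θ ^ (2 : ℝ))),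
      integral_rpow_mul_exp_neg_mul_rpow two_pos
        (by have : (0 : ℝ) ≤ m := by positivity
            linarith) hb0, hb, Real.mul_rpow (by positivity) ht.le]
    rw [hD]; ring
  have hF : 2 * (Real.pi : ℂ) * ((∑ i, c i * heatKernelOne t (n + j i) : ℝ) : ℂ) =
      ∫ θ in (-Real.pi)..Real.pi, ((Real.exp (-2 * t * (1 - Real.cos θ)) : ℝ) : ℂ) *
        Complex.exp (-n * (θ * Complex.I)) *
        ∑ i, (c i : ℂ) * Complex.exp (-(j i) * (θ * Complex.I)) := by
    have e : ∀ θ : ℝ, ((Real.exp (-2 * t * (1 - Real.cos θ)) : ℝ) : ℂ) *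
        Complex.exp (-n * (θ * Complex.I)) *
        ∑ i, (c i : ℂ) * Complex.exp (-(j i) * (θ * Complex.I)) =
        ∑ i, (c i : ℂ) * (((Real.exp (-2 * t * (1 - Real.cos θ)) : ℝ) : ℂ) *
          Complex.exp (-((n + j i : ℤ) : ℂ) * (θ * Complex.I))) := by
      intro θ
      rw [Finset.mul_sum]
      refine Finset.sum_congr rfl fun i _ => ?_
      rw [show -((n + j i : ℤ) : ℂ) * (θ * Complex.I) =
        -n * (θ * Complex.I) + -(j i) * (θ * Complex.I) by push_cast; ring, Complex.exp_add]
      ring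
    simp only [e]
    rw [intervalIntegral.integral_finsetSum fun i _ =>
      Continuous.intervalIntegrable (by fun_prop) _ _]
    simp only [intervalIntegral.integral_const_mul, ← two_pi_mul_heatKernelOne ht.le]
    push_cast
    rw [Finset.mul_sum]
    exact Finset.sum_congr rfl fun i _ => by ring
  have hK : 0 ≤ K := by
    have h := (norm_nonneg _).trans (hP 1)
    simpa using h
  have hbound : ‖2 * (Real.pi : ℂ) * ((∑ i, c i * heatKernelOne t (n + j i) : ℝ) : ℂ)‖ ≤
      ∫ θ in (-Real.pi)..Real.pi, K * ψ θ := by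
    rw [hF]
    refine intervalIntegral.norm_integral_le_of_norm_le (by linarith)
      (Filter.Eventually.of_forall fun θ hθ => ?_) (hint.const_mul K).intervalIntegrable
    rw [norm_mul, norm_mul, Complex.norm_real, Real.norm_of_nonneg (Real.exp_nonneg _),
      show -(n : ℂ) * (θ * Complex.I) = ((-(n : ℝ) * θ : ℝ) : ℂ) * Complex.I by push_cast; ring,
      Complex.norm_exp_ofReal_mul_I, mul_one]
    have hcos := Real.cos_le_one_sub_mul_cos_sq (x := θ) (abs_le.2 ⟨hθ.1.le, hθ.2⟩)
    have h1 : Real.exp (-2 * t * (1 - Real.cos θ)) ≤ Real.exp (-b * |θ| ^ (2 : ℝ)) := by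
      refine Real.exp_le_exp.2 ?_
      rw [Real.rpow_two, sq_abs, hb]
      have := mul_le_mul_of_nonneg_left hcos (by positivity : 0 ≤ 2 * t)
      linear_combination this
    calc _ ≤ Real.exp (-b * |θ| ^ (2 : ℝ)) * (K * |θ| ^ m) :=
          mul_le_mul h1 (hP θ) (norm_nonneg _) (Real.exp_nonneg _)
      _ = K * ψ θ := by rw [hψ]; simp only [Real.rpow_natCast]; ring
  have hle : ∫ θ in (-Real.pi)..Real.pi, K * ψ θ ≤ K * (D * t ^ (-((m : ℝ) + 1) / 2)) := by
    rw [intervalIntegral.integral_const_mul, ← hval,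
      intervalIntegral.integral_of_le (by linarith)]
    refine mul_le_mul_of_nonneg_left (setIntegral_le_integral hint ?_) hK
    exact Filter.Eventually.of_forall fun θ => by simp only [hψ, Pi.zero_apply]; positivity
  have h := hbound.trans hle
  rw [norm_mul, norm_mul, Complex.norm_real, Complex.norm_real, Real.norm_of_nonneg hpi.le,
    Real.norm_eq_abs, Complex.norm_ofNat] at h
  have : |∑ i, c i * heatKernelOne t (n + j i)| ≤
      K * (D * t ^ (-((m : ℝ) + 1) / 2)) / (2 * Real.pi) := by
    rw [le_div_iff₀ (by positivity)]
    linarith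
  refine this.trans_eq ?_
  ring

lemma norm_cexp_neg_ofReal_mul_I_sub_one_le (θ : ℝ) :
    ‖1 - Complex.exp (-(θ * Complex.I))‖ ≤ |θ| := by
  have h := Real.norm_exp_I_mul_ofReal_sub_one_le (x := -θ)
  rw [norm_sub_rev]
  simpa [mul_comm] using h

lemma norm_cexp_second_difference_le (θ : ℝ) :
    ‖Complex.exp (2 * (θ * Complex.I)) - 2 + Complex.exp (-2 * (θ * Complex.I))‖ ≤
      4 * |θ| ^ 2 := by
  have h := norm_cexp_neg_ofReal_mul_I_sub_one_le (2 * θ)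
  have e : Complex.exp (2 * (θ * Complex.I)) - 2 + Complex.exp (-2 * (θ * Complex.I)) =
      Complex.exp (((2 * θ : ℝ) : ℂ) * Complex.I) *
        (1 - Complex.exp (-(((2 * θ : ℝ) : ℂ) * Complex.I))) ^ 2 := by
    rw [show 2 * (θ * Complex.I) = ((2 * θ : ℝ) : ℂ) * Complex.I by push_cast; ring,
      show -2 * (θ * Complex.I) = -(((2 * θ : ℝ) : ℂ) * Complex.I) by push_cast; ring,
      Complex.exp_neg]
    have := Complex.exp_ne_zero (((2 * θ : ℝ) : ℂ) * Complex.I)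
    field_simp
    ring
  rw [e, norm_mul, Complex.norm_exp_ofReal_mul_I, one_mul, norm_pow]
  rw [abs_mul, abs_two] at h
  calc _ ≤ (2 * |θ|) ^ 2 := by gcongr
    _ = _ := by ring

lemma rpow_neg_half_succ {t : ℝ} (ht : 0 < t) (m : ℕ) :
    t ^ (-((m : ℝ) + 1) / 2) = 1 / Real.sqrt t ^ (m + 1) := by
  rw [Real.sqrt_eq_rpow, ← Real.rpow_natCast, ← Real.rpow_mul ht.le, one_div, ← Real.rpow_neg ht.le]
  congr 1
  push_cast
  ring

/-- Bounds for the heat kernel and its differences, uniform in space. -/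
lemma exists_heatKernelOne_difference_bounds : ∃ C : ℝ, 0 < C ∧ ∀ t : ℝ, 0 < t → ∀ n : ℤ,
    heatKernelOne t n ≤ C / √t ∧
    |heatKernelOne t n - heatKernelOne t (n + 1)| ≤ C / √t ^ 2 ∧
    |heatKernelOne t (n - 2) - 2 * heatKernelOne t n + heatKernelOne t (n + 2)| ≤ C / √t ^ 3 ∧
    |(heatKernelOne t (n - 2) - 2 * heatKernelOne t n + heatKernelOne t (n + 2)) -
      (heatKernelOne t (n - 1) - 2 * heatKernelOne t (n + 1) + heatKernelOne t (n + 3))| ≤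
      C / √t ^ 4 := by
  obtain ⟨C0, h0, H0⟩ := exists_abs_sum_heatKernelOne_le 0
  obtain ⟨C1, h1, H1⟩ := exists_abs_sum_heatKernelOne_le 1
  obtain ⟨C2, h2, H2⟩ := exists_abs_sum_heatKernelOne_le 2
  obtain ⟨C3, h3, H3⟩ := exists_abs_sum_heatKernelOne_le 3
  refine ⟨C0 + C1 + 4 * C2 + 4 * C3, by positivity, fun t ht n => ?_⟩
  have hs : 0 < √t := Real.sqrt_pos.2 ht
  refine ⟨?_, ?_, ?_, ?_⟩
  · have h := H0 ![1] ![0] 1 (fun θ => by simp) t ht n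
    rw [rpow_neg_half_succ ht] at h
    simp only [Finset.univ_unique, Finset.sum_singleton, Matrix.cons_val_fin_one, one_mul,
      add_zero] at h
    refine (le_abs_self _).trans (h.trans ?_)
    rw [mul_one_div, zero_add, pow_one]
    gcongr
    linarith
  · have h := H1 ![1, -1] ![0, 1] 1 (fun θ => by
      have h := norm_cexp_neg_ofReal_mul_I_sub_one_le θ
      simpa [Fin.sum_univ_succ, sub_eq_add_neg] using h) t ht n
    rw [rpow_neg_half_succ ht] at h
    simp only [Fin.sum_univ_two, Matrix.cons_val_zero, Matrix.cons_val_one, one_mul,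
      add_zero, neg_mul, ← sub_eq_add_neg] at h
    refine h.trans ?_
    rw [mul_one_div]
    gcongr
    linarith
  · have h := H2 ![1, -2, 1] ![-2, 0, 2] 4 (fun θ => by
      have h := norm_cexp_second_difference_le θ
      refine le_trans (le_of_eq ?_) h
      congr 1
      simp [Fin.sum_univ_succ]
      ring) t ht n
    rw [rpow_neg_half_succ ht] at h
    have e : ∑ i, ![(1 : ℝ), -2, 1] i * heatKernelOne t (n + ![-2, 0, 2] i) =
        heatKernelOne t (n - 2) - 2 * heatKernelOne t n + heatKernelOne t (n + 2) := by
      simp [Fin.sum_univ_succ, ← sub_eq_add_neg]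
      ring
    rw [e] at h
    refine h.trans ?_
    rw [mul_one_div]
    gcongr
    linarith
  -- The symbol is the product of the second-difference symbol and `1 - e^{-iθ}`, hence of size
  -- `4|θ|³`.
  · have h := H3 ![1, -2, 1, -1, 2, -1] ![-2, 0, 2, -1, 1, 3] 4 (fun θ => by
      have ha := norm_cexp_second_difference_le θ
      have hb := norm_cexp_neg_ofReal_mul_I_sub_one_le θ
      have hc := mul_le_mul ha hb (norm_nonneg _) (by positivity)
      rw [← norm_mul] at hc
      refine le_trans (le_of_eq ?_) (hc.trans_eq (by ring))
      congr 1
      have e1 : Complex.exp (-2 * (θ * Complex.I)) * Complex.exp (-(θ * Complex.I)) =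
        Complex.exp (-3 * (θ * Complex.I)) := by rw [← Complex.exp_add]; congr 1; ring
      have e2 : Complex.exp (2 * (θ * Complex.I)) * Complex.exp (-(θ * Complex.I)) =
        Complex.exp (θ * Complex.I) := by rw [← Complex.exp_add]; congr 1; ring
      simp [Fin.sum_univ_succ]
      simp only [neg_mul] at e1
      linear_combination e1 + e2) t ht n
    rw [rpow_neg_half_succ ht] at h
    have e : ∑ i, ![(1 : ℝ), -2, 1, -1, 2, -1] i *
          heatKernelOne t (n + ![-2, 0, 2, -1, 1, 3] i) =
        (heatKernelOne t (n - 2) - 2 * heatKernelOne t n + heatKernelOne t (n + 2)) -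
      (heatKernelOne t (n - 1) - 2 * heatKernelOne t (n + 1) + heatKernelOne t (n + 3)) := by
      simp [Fin.sum_univ_succ, ← sub_eq_add_neg]
      ring
    rw [e] at h
    refine h.trans ?_
    rw [mul_one_div]
    gcongr
    linarith

/-! ### Spatial decay of the one-dimensional kernel and its gradient. -/

lemma sq_mul_heatKernelOne {t : ℝ} (ht : 0 ≤ t) (n : ℤ) :
    (n : ℝ) ^ 2 * heatKernelOne t n =
      t * (t * (heatKernelOne t (n - 2) - 2 * heatKernelOne t n + heatKernelOne t (n + 2)) +
        (heatKernelOne t (n - 1) + heatKernelOne t (n + 1))) := by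
  have e0 := int_mul_heatKernelOne ht n
  have e1 := int_mul_heatKernelOne ht (n - 1)
  have e2 := int_mul_heatKernelOne ht (n + 1)
  rw [show n - 1 - 1 = n - 2 by ring, sub_add_cancel] at e1
  rw [show n + 1 + 1 = n + 2 by ring, add_sub_cancel_right] at e2
  push_cast at e1 e2
  linear_combination n * e0 + t * e1 - t * e2

/-- The profile `√t / (√t + |x|)`, decaying at the diffusive scale `√t`. -/
def diffusiveDecay (t x : ℝ) : ℝ := √t / (√t + |x|)

lemma diffusiveDecay_pos {t : ℝ} (ht : 0 < t) (x : ℝ) : 0 < diffusiveDecay t x := by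
  have := Real.sqrt_pos.2 ht
  unfold diffusiveDecay
  positivity

/-- Bounds on `t · u` and `n² · u` combine into one on `(√t + |n|)² u`. The `n²` bounds come from
expressing `n² G(n)` through differences. Only the gradient bound requires `t ≥ 1`. -/
lemma exists_heatKernelOne_le : ∃ C : ℝ, 0 < C ∧
    (∀ t : ℝ, 0 < t → ∀ n : ℤ, heatKernelOne t n ≤ C / √t) ∧
    (∀ t : ℝ, 0 < t → ∀ n : ℤ, heatKernelOne t n ≤ C / √t * diffusiveDecay t n ^ 2) ∧
    (∀ t : ℝ, 1 ≤ t → ∀ n : ℤ, |heatKernelOne t n - heatKernelOne t (n + 1)| ≤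
      C / √t ^ 2 * diffusiveDecay t n ^ 2) := by
  obtain ⟨C, hC, H⟩ := exists_heatKernelOne_difference_bounds
  -- The gradient case dictates `18 = 2·1 + 2·8`, with `C` bounding `t` times the difference and
  -- `8C` bounding `n²` times it.
  refine ⟨18 * C, by positivity, fun t ht n => ?_, fun t ht n => ?_, fun t ht1 n => ?_⟩
  · have hs : 0 < √t := Real.sqrt_pos.2 ht
    refine (H t ht n).1.trans ?_
    gcongr
    linarith
  · have hs : 0 < √t := Real.sqrt_pos.2 ht
    have hst : √t ^ 2 = t := Real.sq_sqrt ht.le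
    set s := √t with hs'
    have h0 := (H t ht n).1
    have hm := (H t ht (n - 1)).1
    have hp := (H t ht (n + 1)).1
    have h2 := (abs_le.1 (H t ht n).2.2.1).2
    have key : (n : ℝ) ^ 2 * heatKernelOne t n ≤ 3 * C * s := by
      rw [sq_mul_heatKernelOne ht.le]
      calc _ ≤ t * (t * (C / s ^ 3) + (C / s + C / s)) := by gcongr
        _ = 3 * C * s := by rw [← hst]; field_simp; ring
    have key2 : s ^ 2 * heatKernelOne t n ≤ C * s := by
      calc _ ≤ s ^ 2 * (C / s) := by gcongr
        _ = C * s := by field_simp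
    have hsq : (s + |(n : ℝ)|) ^ 2 ≤ 2 * s ^ 2 + 2 * (n : ℝ) ^ 2 := by
      rw [← sq_abs (n : ℝ)]
      nlinarith [sq_nonneg (s - |(n : ℝ)|)]
    have hge := mul_le_mul_of_nonneg_right hsq (heatKernelOne_nonneg ht.le n)
    have e : 18 * C / s * diffusiveDecay t n ^ 2 = 18 * C * s / (s + |(n : ℝ)|) ^ 2 := by
      rw [diffusiveDecay, ← hs']
      field_simp
    rw [e, le_div_iff₀ (by positivity)]
    have : 0 < C * s := by positivity
    linarith
  · have ht : 0 < t := by linarith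
    have hs : 0 < √t := Real.sqrt_pos.2 ht
    have hs1 : 1 ≤ √t := Real.one_le_sqrt.2 ht1
    have hst : √t ^ 2 = t := Real.sq_sqrt ht.le
    set s := √t with hs'
    have hb0 := (H t ht n).2.1
    have hbm := (H t ht (n - 1)).2.1
    have hbp := (H t ht (n + 1)).2.1
    have h3 := (H t ht n).2.2.2
    -- This undifferentiated term is where `t ≥ 1` enters.
    have ha : heatKernelOne t (n + 1) ≤ C :=
      (H t ht (n + 1)).1.trans (div_le_self hC.le hs1)
    have ha0 := heatKernelOne_nonneg ht.le (n + 1)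
    have e0 := sq_mul_heatKernelOne ht.le n
    have e1 := sq_mul_heatKernelOne ht.le (n + 1)
    have e2 := int_mul_heatKernelOne ht.le (n + 1)
    rw [show n + 1 - 2 = n - 1 by ring, show n + 1 - 1 = n by ring, show n + 1 + 1 = n + 2 by ring,
      show n + 1 + 2 = n + 3 by ring] at e1
    rw [show n + 1 - 1 = n by ring, show n + 1 + 1 = n + 2 by ring] at e2
    rw [sub_add_cancel] at hbm
    rw [show n + 1 + 1 = n + 2 by ring] at hbp
    push_cast at e1 e2
    have T : ∀ {x y : ℝ}, 0 ≤ y → |x| ≤ C / y → y ≠ 0 → |y * x| ≤ C := by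
      intro x y hy hx hy0
      rw [abs_mul, abs_of_nonneg hy]
      calc _ ≤ y * (C / y) := by gcongr
        _ = C := by field_simp
    have g0 := abs_le.1 (T (by positivity) hb0 (by positivity))
    have gm := abs_le.1 (T (by positivity) hbm (by positivity))
    have gp := abs_le.1 (T (by positivity) hbp (by positivity))
    have g3 := abs_le.1 (T (by positivity) h3 (by positivity))
    rw [show s ^ 4 = t ^ 2 by rw [← hst]; ring] at g3
    rw [hst] at g0 gm gp
    -- Write it as `n²G(n) - (n+1)²G(n+1) + 2(n+1)G(n+1) - G(n+1)`. The first two terms give a third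
    -- difference and two first differences (`3C`), the next one `4C`, the last one `C`.
    have key : |(n : ℝ) ^ 2 * (heatKernelOne t n - heatKernelOne t (n + 1))| ≤ 8 * C := by
      refine abs_le.2 ⟨?_, ?_⟩
      · linarith
      · linarith
    rw [abs_mul, abs_of_nonneg (sq_nonneg _)] at key
    have key2 := T (by positivity) hb0 (by positivity)
    rw [abs_mul, abs_of_nonneg (sq_nonneg _)] at key2
    have hsq : (s + |(n : ℝ)|) ^ 2 ≤ 2 * s ^ 2 + 2 * (n : ℝ) ^ 2 := by
      rw [← sq_abs (n : ℝ)]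
      nlinarith [sq_nonneg (s - |(n : ℝ)|)]
    have hge := mul_le_mul_of_nonneg_right hsq
      (abs_nonneg (heatKernelOne t n - heatKernelOne t (n + 1)))
    have e : 18 * C / s ^ 2 * diffusiveDecay t n ^ 2 = 18 * C / (s + |(n : ℝ)|) ^ 2 := by
      rw [diffusiveDecay, ← hs']
      field_simp
    rw [e, le_div_iff₀ (by positivity)]
    linarith

lemma diffusiveDecay_le_two_mul {t x y : ℝ} (ht : 0 < t) (h : |x - y| ≤ √t) :
    diffusiveDecay t x ≤ 2 * diffusiveDecay t y := by
  have hs : 0 < √t := Real.sqrt_pos.2 ht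
  unfold diffusiveDecay
  rw [← mul_div_assoc, div_le_div_iff₀ (by positivity) (by positivity)]
  have h1 : |y| ≤ |x| + √t := by
    have := abs_sub_abs_le_abs_sub y x
    rw [abs_sub_comm] at this
    linarith
  nlinarith [abs_nonneg x]

/-- Telescope the gradient bound over at most `√t` unit steps; along them the profile at most
doubles, so its square costs a factor 4. -/
lemma exists_abs_heatKernelOne_sub_le : ∃ C : ℝ, 0 < C ∧
    (∀ t : ℝ, 0 < t → ∀ n : ℤ, heatKernelOne t n ≤ C / √t) ∧
    ∀ t : ℝ, 1 ≤ t → ∀ n k : ℤ, |(k : ℝ)| ≤ √t →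
      heatKernelOne t (n - k) ≤ C / √t * diffusiveDecay t n ^ 2 ∧
      |heatKernelOne t (n - k) - heatKernelOne t n| ≤
        |(k : ℝ)| / √t * (C / √t * diffusiveDecay t n ^ 2) := by
  obtain ⟨C, hC, H0, H1, H2⟩ := exists_heatKernelOne_le
  refine ⟨4 * C, by positivity, fun t ht n => (H0 t ht n).trans ?_, fun t ht1 n k hk => ?_⟩
  · gcongr; linarith
  have ht : 0 < t := by linarith
  have hs : 0 < √t := Real.sqrt_pos.2 ht
  have shift : ∀ m : ℤ, |((m - n : ℤ) : ℝ)| ≤ √t →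
      diffusiveDecay t m ^ 2 ≤ 4 * diffusiveDecay t n ^ 2 := by
    intro m hm
    push_cast at hm
    calc _ ≤ (2 * diffusiveDecay t n) ^ 2 := by
          have := diffusiveDecay_pos ht m
          gcongr
          exact diffusiveDecay_le_two_mul ht hm
      _ = _ := by ring
  refine ⟨?_, ?_⟩
  · calc _ ≤ C / √t * diffusiveDecay t (n - k : ℤ) ^ 2 := H1 t ht _
      _ ≤ C / √t * (4 * diffusiveDecay t n ^ 2) := by
          gcongr
          refine shift _ ?_
          simpa using hk
      _ = _ := by ring
  · have step : ∀ m : ℤ, |((m - n : ℤ) : ℝ)| ≤ √t →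
        |heatKernelOne t m - heatKernelOne t (m + 1)| ≤
          4 * C / √t ^ 2 * diffusiveDecay t n ^ 2 := by
      intro m hm
      calc _ ≤ C / √t ^ 2 * diffusiveDecay t m ^ 2 := H2 t ht1 m
        _ ≤ C / √t ^ 2 * (4 * diffusiveDecay t n ^ 2) := by gcongr; exact shift m hm
        _ = _ := by ring
    have up : ∀ j : ℕ, (j : ℝ) ≤ √t → |heatKernelOne t (n + j) - heatKernelOne t n| ≤
        j * (4 * C / √t ^ 2 * diffusiveDecay t n ^ 2) := by
      intro j
      induction j with
      | zero => simp
      | succ j ih =>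
        intro hj
        push_cast at hj
        have h1 := ih (by linarith)
        have h2 := step (n + j) (by simp; linarith)
        rw [abs_sub_comm] at h2
        have h3 := abs_add_le (heatKernelOne t (n + j + 1) - heatKernelOne t (n + j))
          (heatKernelOne t (n + j) - heatKernelOne t n)
        rw [sub_add_sub_cancel] at h3
        push_cast
        rw [← add_assoc]
        linarith
    have down : ∀ j : ℕ, (j : ℝ) ≤ √t → |heatKernelOne t (n - j) - heatKernelOne t n| ≤
        j * (4 * C / √t ^ 2 * diffusiveDecay t n ^ 2) := by
      intro j
      induction j with
      | zero => simp
      | succ j ih =>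
        intro hj
        push_cast at hj
        have h1 := ih (by linarith)
        have h2 := step (n - (j + 1)) (by
          push_cast
          rw [abs_le]
          constructor <;> linarith)
        rw [show n - ((j : ℤ) + 1) + 1 = n - j by ring] at h2
        have h3 := abs_add_le (heatKernelOne t (n - (j + 1)) - heatKernelOne t (n - j))
          (heatKernelOne t (n - j) - heatKernelOne t n)
        rw [sub_add_sub_cancel] at h3
        push_cast
        linarith
    have e : |(k : ℝ)| / √t * (4 * C / √t * diffusiveDecay t n ^ 2) =
        |(k : ℝ)| * (4 * C / √t ^ 2 * diffusiveDecay t n ^ 2) := by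
      field_simp
    rw [e]
    obtain ⟨j, rfl | rfl⟩ := k.eq_nat_or_neg
    · simpa using down j (by simpa using hk)
    · simpa using up j (by simpa using hk)

/-! ### Summing powers of the decay profile. -/

/-- A discrete integral test: the right side telescopes along `x, x + 1, …`. -/
lemma div_add_one_rpow_le {s x ρ : ℝ} (hs : 0 < s) (hx : 0 < x) (hρ : 1 < ρ) :
    (s / (x + 1)) ^ ρ ≤
      s / (ρ - 1) * ((s / x) ^ (ρ - 1) - (s / (x + 1)) ^ (ρ - 1)) := by
  have hc : 0 < ρ - 1 := by linarith
  have e1 : (s / (x + 1)) ^ ρ = (s / (x + 1)) ^ (ρ - 1) * (s / (x + 1)) := by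
    rw [← Real.rpow_add_one (by positivity)]
    congr 1; ring
  have e2 : (s / x) ^ (ρ - 1) = (s / (x + 1)) ^ (ρ - 1) * ((x + 1) / x) ^ (ρ - 1) := by
    rw [← Real.mul_rpow (by positivity) (by positivity)]
    congr 1; field_simp
  have e3 : 1 + (ρ - 1) / (x + 1) ≤ ((x + 1) / x) ^ (ρ - 1) := by
    rw [Real.rpow_def_of_pos (by positivity)]
    have h1 := Real.one_sub_inv_le_log_of_pos (show 0 < (x + 1) / x by positivity)
    have h2 : 1 - ((x + 1) / x)⁻¹ = 1 / (x + 1) := by field_simp; ring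
    rw [h2] at h1
    have h3 := Real.add_one_le_exp (Real.log ((x + 1) / x) * (ρ - 1))
    have h4 := mul_le_mul_of_nonneg_right h1 hc.le
    have h5 : 1 / (x + 1) * (ρ - 1) = (ρ - 1) / (x + 1) := by ring
    linarith
  rw [e1, e2]
  have hp : 0 < (s / (x + 1)) ^ (ρ - 1) := by positivity
  calc _ = s / (ρ - 1) * ((s / (x + 1)) ^ (ρ - 1) * ((ρ - 1) / (x + 1))) := by field_simp
    _ ≤ s / (ρ - 1) * ((s / (x + 1)) ^ (ρ - 1) * (((x + 1) / x) ^ (ρ - 1) - 1)) := by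
        gcongr; linarith
    _ = _ := by ring

lemma tsum_diffusiveDecay_rpow_le {ρ : ℝ} (hρ : 1 < ρ) {t : ℝ} (ht : 1 ≤ t) :
    ∑' j : ℤ, ENNReal.ofReal (diffusiveDecay t j ^ ρ) ≤
      ENNReal.ofReal ((1 + 2 / (ρ - 1)) * √t) := by
  have ht0 : 0 < t := by linarith
  have hs : 0 < √t := Real.sqrt_pos.2 ht0
  have hs1 : 1 ≤ √t := Real.one_le_sqrt.2 ht
  have hc : 0 < ρ - 1 := by linarith
  set F : ℤ → ℝ≥0∞ := fun j => ENNReal.ofReal (diffusiveDecay t j ^ ρ) with hF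
  have partialSum : ∀ M : ℕ, ∑ n ∈ Finset.range M, (√t / (√t + n + 1)) ^ ρ ≤ √t / (ρ - 1) := by
    intro M
    have : ∑ n ∈ Finset.range M, (√t / (√t + n + 1)) ^ ρ ≤
        √t / (ρ - 1) * (1 - (√t / (√t + M)) ^ (ρ - 1)) := by
      induction M with
      | zero => simp [hs.ne']
      | succ M ih =>
        rw [Finset.sum_range_succ]
        have := div_add_one_rpow_le hs (show 0 < √t + M by positivity) hρ
        push_cast
        rw [← add_assoc]
        linarith
    refine this.trans ?_
    have h1 : 0 ≤ (√t / (√t + M)) ^ (ρ - 1) := by positivity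
    calc _ ≤ √t / (ρ - 1) * 1 := by gcongr; linarith
      _ = _ := by ring
  have hpos : ∑' n : ℕ, F (n + 1) ≤ ENNReal.ofReal (√t / (ρ - 1)) := by
    refine ENNReal.tsum_le_of_sum_range_le fun M => ?_
    have e : ∀ n : ℕ, F (n + 1) = ENNReal.ofReal ((√t / (√t + n + 1)) ^ ρ) := by
      intro n
      simp only [hF, diffusiveDecay]
      push_cast
      rw [abs_of_nonneg (by positivity), ← add_assoc]
    simp only [e]
    rw [← ENNReal.ofReal_sum_of_nonneg fun n _ => by positivity]
    exact ENNReal.ofReal_le_ofReal (partialSum M)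
  have hneg : ∀ j, F (-j) = F j := by intro j; simp [hF, diffusiveDecay]
  have h := HasSum.of_nat_of_neg_add_one (f := F) ENNReal.summable.hasSum ENNReal.summable.hasSum
  rw [h.tsum_eq]
  simp only [hneg]
  rw [tsum_eq_zero_add' (f := fun b : ℕ => F b) ENNReal.summable]
  have h0 : F ((0 : ℕ) : ℤ) = ENNReal.ofReal 1 := by simp [hF, diffusiveDecay, hs.ne']
  rw [h0]
  push_cast
  calc _ ≤ ENNReal.ofReal 1 + ENNReal.ofReal (√t / (ρ - 1)) + ENNReal.ofReal (√t / (ρ - 1)) := by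
        gcongr
    _ = ENNReal.ofReal (1 + √t / (ρ - 1) + √t / (ρ - 1)) := by
        rw [← ENNReal.ofReal_add (by positivity) (by positivity),
          ← ENNReal.ofReal_add (by positivity) (by positivity)]
    _ ≤ _ := by
        refine ENNReal.ofReal_le_ofReal ?_
        have : (1 + 2 / (ρ - 1)) * √t = √t + √t / (ρ - 1) + √t / (ρ - 1) := by ring
        linarith

/-! ### Product structure and the increment estimate on `ℤ^N`. -/

lemma ENNReal.tsum_fin_prod {α : Type*} (N : ℕ) (F : α → ℝ≥0∞) :
    ∑' k : Fin N → α, ∏ i, F (k i) = (∑' j, F j) ^ N := by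
  induction N with
  | zero => simp
  | succ N ih =>
    rw [← (Fin.consEquiv fun _ : Fin (N + 1) => α).tsum_eq, pow_succ', ← ih]
    have e : ∀ p : α × (Fin N → α),
        ∏ i, F ((Fin.consEquiv fun _ : Fin (N + 1) => α) p i) = F p.1 * ∏ i, F (p.2 i) := by
      intro p
      rw [Fin.prod_univ_succ]
      simp [Fin.consEquiv]
    simp only [e]
    rw [ENNReal.tsum_prod (f := fun a (b : Fin N → α) => F a * ∏ i, F (b i))]
    simp only [ENNReal.tsum_mul_left, ENNReal.tsum_mul_right]

lemma latticeAbs_nonneg {N : ℕ} (k : Fin N → ℤ) : 0 ≤ latticeAbs k :=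
  Finset.sum_nonneg fun _ _ => abs_nonneg _

lemma abs_apply_le_latticeAbs {N : ℕ} (k : Fin N → ℤ) (i : Fin N) :
    |(k i : ℝ)| ≤ latticeAbs k :=
  Finset.single_le_sum (f := fun i => |(k i : ℝ)|) (fun _ _ => abs_nonneg _) (Finset.mem_univ i)

lemma one_le_latticeAbs {N : ℕ} {k : Fin N → ℤ} (hk : k ≠ 0) : 1 ≤ latticeAbs k := by
  obtain ⟨i, hi⟩ := Function.ne_iff.1 hk
  refine le_trans ?_ (abs_apply_le_latticeAbs k i)
  exact_mod_cast Int.one_le_abs hi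

lemma diffusiveDecay_le_one {t : ℝ} (ht : 0 < t) (x : ℝ) : diffusiveDecay t x ≤ 1 := by
  have hs : 0 < √t := Real.sqrt_pos.2 ht
  exact div_le_one_of_le₀ (by linarith [abs_nonneg x]) (by positivity)

lemma heatKernel_nonneg {N : ℕ} {t : ℝ} (ht : 0 < t) (n : Fin N → ℤ) : 0 ≤ heatKernel t n := by
  rw [heatKernel_eq_prod ht]
  exact Finset.prod_nonneg fun _ _ => heatKernelOne_nonneg ht.le _

lemma tsum_ofReal_heatKernel (N : ℕ) {t : ℝ} (ht : 0 < t) :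
    ∑' n : Fin N → ℤ, ENNReal.ofReal (heatKernel t n) = 1 := by
  have h1 : ∑' j : ℤ, ENNReal.ofReal (heatKernelOne t j) = 1 := by
    rw [← ENNReal.ofReal_tsum_of_nonneg (heatKernelOne_nonneg ht.le)
      (hasSum_heatKernelOne ht.le).summable, (hasSum_heatKernelOne ht.le).tsum_eq,
      ENNReal.ofReal_one]
  simp only [heatKernel_eq_prod ht,
    ENNReal.ofReal_prod_of_nonneg fun _ _ => heatKernelOne_nonneg ht.le _]
  rw [ENNReal.tsum_fin_prod N fun j => ENNReal.ofReal (heatKernelOne t j), h1, one_pow]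

lemma abs_prod_sub_prod_le {ι : Type*} (s : Finset ι) {x y e M : ι → ℝ} (he : ∀ i, 0 ≤ e i)
    (hx : ∀ i, |x i| ≤ M i) (hy : ∀ i, |y i| ≤ M i) (hxy : ∀ i, |x i - y i| ≤ e i * M i) :
    |∏ i ∈ s, x i - ∏ i ∈ s, y i| ≤ (∑ i ∈ s, e i) * ∏ i ∈ s, M i := by
  classical
  induction s using Finset.induction_on with
  | empty => simp
  | insert a s ha ih =>
    rw [Finset.prod_insert ha, Finset.prod_insert ha, Finset.prod_insert ha, Finset.sum_insert ha]
    have hM : ∀ i, 0 ≤ M i := fun i => (abs_nonneg _).trans (hx i)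
    have h1 : |∏ i ∈ s, y i| ≤ ∏ i ∈ s, M i := by
      rw [Finset.abs_prod]
      exact Finset.prod_le_prod (fun _ _ => abs_nonneg _) fun i _ => hy i
    have hP : 0 ≤ ∏ i ∈ s, M i := Finset.prod_nonneg fun i _ => hM i
    calc |x a * ∏ i ∈ s, x i - y a * ∏ i ∈ s, y i|
        = |x a * (∏ i ∈ s, x i - ∏ i ∈ s, y i) + (x a - y a) * ∏ i ∈ s, y i| := by
          congr 1; ring
      _ ≤ |x a| * |∏ i ∈ s, x i - ∏ i ∈ s, y i| + |x a - y a| * |∏ i ∈ s, y i| := by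
          rw [← abs_mul, ← abs_mul]; exact abs_add_le _ _
      _ ≤ M a * ((∑ i ∈ s, e i) * ∏ i ∈ s, M i) + (e a * M a) * ∏ i ∈ s, M i := by
          refine add_le_add (mul_le_mul (hx a) ih (abs_nonneg _) (hM a))
            (mul_le_mul (hxy a) h1 (abs_nonneg _) (mul_nonneg (he a) (hM a)))
      _ = _ := by ring

/-- For `t < 1` every nonzero `k` lies outside the ball of radius `√t`, so `Ψ = G` suffices. For `t
≥ 1` one adds to `G` the product `Φ` of the one-dimensional majorants, which governs the increments
inside the ball. -/
lemma exists_abs_heatKernel_sub_le (N : ℕ) : ∃ C : ℝ, 0 < C ∧ ∀ t : ℝ, 0 < t →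
    (∀ n : Fin N → ℤ, heatKernel t n ≤ C / √t ^ N) ∧
    ∃ Ψ : (Fin N → ℤ) → ℝ, (∀ n, 0 ≤ Ψ n) ∧ (∀ n, Ψ n ≤ C / √t ^ N) ∧
      ∑' n, ENNReal.ofReal (Ψ n) ≤ ENNReal.ofReal C ∧
      ∀ n k, |heatKernel t (n - k) - heatKernel t n| ≤
        2 * (latticeAbs k / √t) *
          (heatKernel t (n - k) + Ψ n * diffusiveDecay t (latticeAbs k)) := by
  obtain ⟨D, hD, H0, H1⟩ := exists_abs_heatKernelOne_sub_le
  set B : ℝ := 1 + D ^ N + (3 * D) ^ N with hB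
  have hB0 : 0 < B := by positivity
  have hG : ∀ t : ℝ, 0 < t → ∀ n : Fin N → ℤ, heatKernel t n ≤ D ^ N / √t ^ N := by
    intro t ht n
    rw [heatKernel_eq_prod ht, ← div_pow]
    calc _ ≤ ∏ _i : Fin N, D / √t :=
          Finset.prod_le_prod (fun _ _ => heatKernelOne_nonneg ht.le _) fun i _ => H0 t ht _
      _ = _ := by simp [div_pow]
  -- the trivial bound, away from the diffusive ball
  have far : ∀ t : ℝ, 0 < t → ∀ n k : Fin N → ℤ, √t ≤ latticeAbs k →
      |heatKernel t (n - k) - heatKernel t n| ≤ 2 * (latticeAbs k / √t) *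
          (heatKernel t (n - k) + heatKernel t n * diffusiveDecay t (latticeAbs k)) := by
    intro t ht n k hk
    have hs : 0 < √t := Real.sqrt_pos.2 ht
    have g1 := heatKernel_nonneg ht (n - k)
    have g2 := heatKernel_nonneg ht n
    have e1 : 1 ≤ latticeAbs k / √t := (one_le_div hs).2 hk
    have e2 : 1 ≤ 2 * (latticeAbs k / √t) * diffusiveDecay t (latticeAbs k) := by
      rw [diffusiveDecay, abs_of_nonneg (latticeAbs_nonneg k)]
      have : 2 * (latticeAbs k / √t) * (√t / (√t + latticeAbs k)) =
        2 * latticeAbs k / (√t + latticeAbs k) := by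
          field_simp
      rw [this, one_le_div (by linarith [latticeAbs_nonneg k])]
      linarith
    have e3 : |heatKernel t (n - k) - heatKernel t n| ≤ heatKernel t (n - k) + heatKernel t n := by
      rw [abs_le]; constructor <;> linarith
    nlinarith
  refine ⟨2 * B, by positivity, fun t ht => ⟨fun n => (hG t ht n).trans ?_, ?_⟩⟩
  · gcongr
    have : 0 < (3 * D) ^ N := by positivity
    have : 0 < D ^ N := by positivity
    linarith
  have hs : 0 < √t := Real.sqrt_pos.2 ht
  have hD3 : 0 < (3 * D) ^ N := by positivity
  have hD1 : 0 < D ^ N := by positivity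
  rcases lt_or_ge t 1 with ht1 | ht1
  · refine ⟨heatKernel t, heatKernel_nonneg ht, fun n => (hG t ht n).trans ?_, ?_, fun n k => ?_⟩
    · gcongr; linarith
    · rw [tsum_ofReal_heatKernel N ht, ← ENNReal.ofReal_one]
      exact ENNReal.ofReal_le_ofReal (by linarith)
    · rcases eq_or_ne k 0 with rfl | hk
      · simp [latticeAbs]
      · refine far t ht n k (le_trans ?_ (one_le_latticeAbs hk))
        exact Real.sqrt_le_one.2 ht1.le
  · set Φ : (Fin N → ℤ) → ℝ := fun n => ∏ i, (D / √t * diffusiveDecay t (n i) ^ 2) with hΦ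
    have hM0 : ∀ j : ℤ, 0 ≤ D / √t * diffusiveDecay t j ^ 2 := fun j => by positivity
    have hΦ0 : ∀ n, 0 ≤ Φ n := fun n => Finset.prod_nonneg fun i _ => hM0 _
    have hΦle : ∀ n, Φ n ≤ D ^ N / √t ^ N := by
      intro n
      rw [← div_pow]
      calc Φ n ≤ ∏ _i : Fin N, D / √t := by
            refine Finset.prod_le_prod (fun _ _ => hM0 _) fun i _ => ?_
            have h1 := diffusiveDecay_le_one ht (n i : ℝ)
            have h2 := diffusiveDecay_pos ht (n i : ℝ)
            refine mul_le_of_le_one_right (by positivity) (pow_le_one₀ h2.le h1)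
        _ = _ := by simp [div_pow]
    have hΦsum : ∑' n, ENNReal.ofReal (Φ n) ≤ ENNReal.ofReal ((3 * D) ^ N) := by
      simp only [hΦ, ENNReal.ofReal_prod_of_nonneg fun _ _ => hM0 _]
      rw [ENNReal.tsum_fin_prod N fun j : ℤ => ENNReal.ofReal (D / √t * diffusiveDecay t j ^ 2),
        ENNReal.ofReal_pow (by positivity)]
      gcongr
      have h := tsum_diffusiveDecay_rpow_le (ρ := 2) (by norm_num) ht1
      simp only [Real.rpow_two] at h
      have e : ∀ j : ℤ, ENNReal.ofReal (D / √t * diffusiveDecay t j ^ 2) =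
        ENNReal.ofReal (D / √t) * ENNReal.ofReal (diffusiveDecay t j ^ 2) :=
        fun j => ENNReal.ofReal_mul (by positivity)
      simp only [e, ENNReal.tsum_mul_left]
      calc _ ≤ ENNReal.ofReal (D / √t) * ENNReal.ofReal ((1 + 2 / (2 - 1)) * √t) := by gcongr
        _ = _ := by
          rw [← ENNReal.ofReal_mul (by positivity)]
          congr 1
          field_simp
          norm_num
    refine ⟨fun n => heatKernel t n + Φ n, fun n => add_nonneg (heatKernel_nonneg ht n) (hΦ0 n),
      fun n => ?_, ?_, fun n k => ?_⟩
    · refine (add_le_add (hG t ht n) (hΦle n)).trans ?_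
      rw [← add_div]
      gcongr
      linarith
    · simp only [ENNReal.ofReal_add (heatKernel_nonneg ht _) (hΦ0 _)]
      rw [ENNReal.tsum_add, tsum_ofReal_heatKernel N ht, ← ENNReal.ofReal_one]
      refine (add_le_add le_rfl hΦsum).trans ?_
      rw [← ENNReal.ofReal_add zero_le_one hD3.le]
      exact ENNReal.ofReal_le_ofReal (by linarith)
    · have hu := diffusiveDecay_pos ht (latticeAbs k)
      have hl : 0 ≤ latticeAbs k / √t := div_nonneg (latticeAbs_nonneg k) hs.le
      rcases le_total (√t) (latticeAbs k) with hk | hk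
      · refine (far t ht n k hk).trans ?_
        gcongr
        linarith [hΦ0 n]
      · have near : |heatKernel t (n - k) - heatKernel t n| ≤ latticeAbs k / √t * Φ n := by
          rw [heatKernel_eq_prod ht, heatKernel_eq_prod ht]
          have h := abs_prod_sub_prod_le Finset.univ
            (x := fun i => heatKernelOne t ((n - k) i)) (y := fun i => heatKernelOne t (n i))
            (e := fun i => |(k i : ℝ)| / √t)
            (M := fun i => D / √t * diffusiveDecay t (n i) ^ 2)
            (fun i => by positivity)
            (fun i => by
              rw [abs_of_nonneg (heatKernelOne_nonneg ht.le _)]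
              exact (H1 t ht1 (n i) (k i) ((abs_apply_le_latticeAbs k i).trans hk)).1)
            (fun i => by
              rw [abs_of_nonneg (heatKernelOne_nonneg ht.le _)]
              simpa using (H1 t ht1 (n i) 0 (by simp)).1)
            (fun i => (H1 t ht1 (n i) (k i) ((abs_apply_le_latticeAbs k i).trans hk)).2)
          rwa [← Finset.sum_div] at h
        -- Inside the ball the profile is at least `1/2`, so inserting it costs only a factor 2.
        have e2 : 1 ≤ 2 * diffusiveDecay t (latticeAbs k) := by
          rw [diffusiveDecay, abs_of_nonneg (latticeAbs_nonneg k), ← mul_div_assoc,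
            one_le_div (by linarith [latticeAbs_nonneg k])]
          linarith
        have g1 := heatKernel_nonneg ht (n - k)
        have g2 := heatKernel_nonneg ht n
        refine near.trans ?_
        calc latticeAbs k / √t * Φ n
            ≤ latticeAbs k / √t * (Φ n * (2 * diffusiveDecay t (latticeAbs k))) := by
              gcongr
              exact le_mul_of_one_le_right (hΦ0 n) e2
          _ = 2 * (latticeAbs k / √t) * (0 + (0 + Φ n) * diffusiveDecay t (latticeAbs k)) := by
              ring
          _ ≤ _ := by
              gcongr
              exact add_le_add_left g2 _

/-! ### Hölder's inequality against the decay profile. -/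

lemma ENNReal.tsum_mul_le_Lp_mul_Lq {ι : Type*} {p q : ℝ} (h : p.HolderConjugate q)
    (f g : ι → ℝ≥0∞) :
    ∑' i, f i * g i ≤ (∑' i, f i ^ p) ^ (1 / p) * (∑' i, g i ^ q) ^ (1 / q) := by
  let _ : MeasurableSpace ι := ⊤
  have := ENNReal.lintegral_mul_le_Lp_mul_Lq (Measure.count : Measure ι) h
    (f := f) (g := g) (Measurable.of_discrete.aemeasurable) (Measurable.of_discrete.aemeasurable)
  simpa [lintegral_count] using this

/-- Split the power `r` into `N` equal factors and use `|k| ≥ |k_i|` in the `i`-th: the sum is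
dominated by a product of one-dimensional sums with exponent `r/N > 1`. -/
lemma tsum_diffusiveDecay_latticeAbs_rpow_le {N : ℕ} (hN : 1 ≤ N) {r : ℝ} (hr : (N : ℝ) < r) :
    ∃ C : ℝ, 0 < C ∧ ∀ t : ℝ, 1 ≤ t →
      ∑' k : Fin N → ℤ, ENNReal.ofReal (diffusiveDecay t (latticeAbs k)) ^ r ≤
        ENNReal.ofReal (C * √t) ^ N := by
  have hN0 : (0 : ℝ) < N := by exact_mod_cast hN
  have hρ : 1 < r / N := (one_lt_div hN0).2 hr
  have hc : 0 < r / N - 1 := by linarith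
  refine ⟨1 + 2 / (r / N - 1), by positivity, fun t ht1 => ?_⟩
  have ht : 0 < t := by linarith
  have hs : 0 < √t := Real.sqrt_pos.2 ht
  refine le_trans ?_ (pow_le_pow_left' (tsum_diffusiveDecay_rpow_le hρ ht1) N)
  rw [← ENNReal.tsum_fin_prod]
  refine ENNReal.tsum_le_tsum fun k => ?_
  have hv := diffusiveDecay_pos ht (latticeAbs k)
  have e : ENNReal.ofReal (diffusiveDecay t (latticeAbs k)) ^ r =
      ∏ _i : Fin N, ENNReal.ofReal (diffusiveDecay t (latticeAbs k) ^ (r / N)) := by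
    rw [Finset.prod_const, Finset.card_univ, Fintype.card_fin, ← ENNReal.ofReal_pow (by positivity),
      ← Real.rpow_natCast, ← Real.rpow_mul hv.le, div_mul_cancel₀ _ hN0.ne',
      ENNReal.ofReal_rpow_of_pos hv]
  rw [e]
  refine Finset.prod_le_prod' fun i _ => ENNReal.ofReal_le_ofReal ?_
  refine Real.rpow_le_rpow hv.le ?_ (by linarith)
  rw [diffusiveDecay, diffusiveDecay, abs_of_nonneg (latticeAbs_nonneg k)]
  gcongr
  exact abs_apply_le_latticeAbs k i

lemma exists_tsum_mul_diffusiveDecay_le {N : ℕ} (hN : 1 ≤ N) {q : ℝ} (hq : 1 ≤ q)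
    (hqN : q * ((N : ℝ) - 1) < N) : ∃ C : ℝ, 0 < C ∧ ∀ t : ℝ, 0 < t →
      ∀ g : (Fin N → ℤ) → ℝ≥0∞, g 0 = 0 →
        ∑' k, g k * ENNReal.ofReal (diffusiveDecay t (latticeAbs k)) ≤
          ENNReal.ofReal (C * √t ^ ((N : ℝ) * (1 - 1 / q))) * (∑' k, g k ^ q) ^ (1 / q) := by
  have hN0 : (0 : ℝ) < N := by exact_mod_cast hN
  rcases hq.eq_or_lt with rfl | hq1
  · refine ⟨1, one_pos, fun t ht g _ => ?_⟩
    simp only [one_div, inv_one, sub_self, mul_zero, Real.rpow_zero, mul_one, ENNReal.ofReal_one,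
      ENNReal.rpow_one, one_mul]
    refine ENNReal.tsum_le_tsum fun k => mul_le_of_le_one_right' ?_
    rw [← ENNReal.ofReal_one]
    exact ENNReal.ofReal_le_ofReal (diffusiveDecay_le_one ht _)
  have hconj := Real.HolderConjugate.conjExponent hq1
  set r := q.conjExponent with hr
  have hr0 : 0 < r := hconj.symm.pos
  have hinv : 1 - 1 / q = 1 / r := by
    have := hconj.inv_add_inv_eq_one
    rw [one_div, one_div]; linarith
  have hrN : (N : ℝ) < r := by
    rw [hr, Real.conjExponent, lt_div_iff₀ (by linarith)]
    linarith
  obtain ⟨C, hC, H⟩ := tsum_diffusiveDecay_latticeAbs_rpow_le hN hrN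
  have large : ∀ t : ℝ, 1 ≤ t → ∀ g : (Fin N → ℤ) → ℝ≥0∞,
      ∑' k, g k * ENNReal.ofReal (diffusiveDecay t (latticeAbs k)) ≤
        ENNReal.ofReal (C ^ ((N : ℝ) * (1 - 1 / q)) * √t ^ ((N : ℝ) * (1 - 1 / q))) *
          (∑' k, g k ^ q) ^ (1 / q) := by
    intro t ht1 g
    have hs : 0 < √t := Real.sqrt_pos.2 (by linarith)
    refine (ENNReal.tsum_mul_le_Lp_mul_Lq hconj _ _).trans ?_
    rw [mul_comm]
    gcongr
    calc _ ≤ (ENNReal.ofReal (C * √t) ^ N) ^ (1 / r) := by gcongr; exact H t ht1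
      _ = _ := by
        rw [← ENNReal.rpow_natCast, ← ENNReal.rpow_mul, ENNReal.ofReal_rpow_of_pos (by positivity),
          hinv, Real.mul_rpow hC.le hs.le]
  refine ⟨2 * C ^ ((N : ℝ) * (1 - 1 / q)), by positivity, fun t ht g hg => ?_⟩
  have hs : 0 < √t := Real.sqrt_pos.2 ht
  rcases le_or_gt 1 t with ht1 | ht1
  · refine (large t ht1 g).trans ?_
    gcongr
    have : 0 < C ^ ((N : ℝ) * (1 - 1 / q)) := by positivity
    linarith
  · have hs1 : √t ≤ 1 := Real.sqrt_le_one.2 ht1.le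
    -- For small `t`, reduce to `t = 1` at the price of `2√t`. This fails at `k = 0`, where the
    -- profile equals 1, hence the condition `g 0 = 0`. The factor suffices because `√t ≤ √t^(N/r)`
    -- when `N < r`.
    have hpt : ∀ k, g k * ENNReal.ofReal (diffusiveDecay t (latticeAbs k)) ≤
        ENNReal.ofReal (2 * √t) * (g k * ENNReal.ofReal (diffusiveDecay 1 (latticeAbs k))) := by
      intro k
      rcases eq_or_ne k 0 with rfl | hk
      · simp [hg]
      · rw [mul_left_comm, ← ENNReal.ofReal_mul (by positivity)]
        gcongr
        have h1 := one_le_latticeAbs hk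
        rw [diffusiveDecay, diffusiveDecay, Real.sqrt_one, abs_of_nonneg (by linarith),
          mul_one_div, div_le_div_iff₀ (by linarith) (by linarith)]
        nlinarith
    refine (ENNReal.tsum_le_tsum hpt).trans ?_
    rw [ENNReal.tsum_mul_left]
    refine (mul_le_mul_right (large 1 le_rfl g) _).trans ?_
    rw [← mul_assoc, ← ENNReal.ofReal_mul (by positivity), Real.sqrt_one, Real.one_rpow, mul_one]
    refine mul_le_mul_left (ENNReal.ofReal_le_ofReal ?_) _
    have h1 : √t ≤ √t ^ ((N : ℝ) * (1 - 1 / q)) := by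
      refine Real.self_le_rpow_of_le_one hs.le hs1 ?_
      rw [hinv, mul_one_div]
      exact div_le_one_of_le₀ hrN.le hr0.le
    have h2 : 0 < C ^ ((N : ℝ) * (1 - 1 / q)) := by positivity
    nlinarith

/-! ### Jensen, Minkowski, Young and interpolation inequalities for sums. -/

section Discrete

variable {ι : Type*}

lemma ENNReal.tsum_mul_le_rpow_of_tsum_le_one {q : ℝ} (hq : 1 ≤ q) {w : ι → ℝ≥0∞}
    (hw : ∑' i, w i ≤ 1) (f : ι → ℝ≥0∞) :
    ∑' i, w i * f i ≤ (∑' i, w i * f i ^ q) ^ (1 / q) := by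
  rw [ENNReal.tsum_eq_iSup_sum]
  refine iSup_le fun s => ?_
  refine (ENNReal.inner_le_weight_mul_Lp_of_nonneg s hq w f).trans ?_
  have hq' : 0 ≤ 1 - q⁻¹ := by
    have := inv_le_one_of_one_le₀ hq
    linarith
  rw [one_div]
  calc _ ≤ 1 ^ (1 - q⁻¹) * (∑' i, w i * f i ^ q) ^ q⁻¹ := by
        gcongr
        · exact (ENNReal.sum_le_tsum s).trans hw
        · exact ENNReal.sum_le_tsum s
    _ = _ := by rw [ENNReal.one_rpow, one_mul]

lemma ENNReal.tsum_add_rpow_le {q : ℝ} (hq : 1 ≤ q) (f g : ι → ℝ≥0∞) :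
    (∑' i, (f i + g i) ^ q) ^ (1 / q) ≤
      (∑' i, f i ^ q) ^ (1 / q) + (∑' i, g i ^ q) ^ (1 / q) := by
  let _ : MeasurableSpace ι := ⊤
  have := ENNReal.lintegral_Lp_add_le (μ := (Measure.count : Measure ι)) (f := f) (g := g)
    Measurable.of_discrete.aemeasurable Measurable.of_discrete.aemeasurable hq
  simpa [lintegral_count] using this

lemma ENNReal.tsum_mul_left_rpow {q : ℝ} (hq : 0 < q) (c : ℝ≥0∞) (f : ι → ℝ≥0∞) :
    (∑' i, (c * f i) ^ q) ^ (1 / q) = c * (∑' i, f i ^ q) ^ (1 / q) := by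
  simp only [ENNReal.mul_rpow_of_nonneg _ _ hq.le]
  rw [ENNReal.tsum_mul_left, ENNReal.mul_rpow_of_nonneg _ _ (by positivity), ← ENNReal.rpow_mul,
    mul_one_div_cancel hq.ne', ENNReal.rpow_one]

/-- Interpolation of `ℓ^q` between `ℓ^1` and `ℓ^∞`. -/
lemma ENNReal.tsum_rpow_le_of_le {q : ℝ} (hq : 1 ≤ q) {F : ι → ℝ≥0∞} {B S : ℝ≥0∞}
    (hB : ∀ i, F i ≤ B) (hS : ∑' i, F i ≤ S) :
    (∑' i, F i ^ q) ^ (1 / q) ≤ B ^ (1 - 1 / q) * S ^ (1 / q) := by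
  have hq0 : 0 < q := by linarith
  have h : ∑' i, F i ^ q ≤ B ^ (q - 1) * S := by
    calc _ ≤ ∑' i, B ^ (q - 1) * F i := by
          refine ENNReal.tsum_le_tsum fun i => ?_
          calc F i ^ q = F i ^ (q - 1) * F i := by
                conv_rhs => rw [← ENNReal.rpow_one (F i), ← ENNReal.rpow_mul, one_mul]
                rw [← ENNReal.rpow_add_of_nonneg _ _ (by linarith) zero_le_one, sub_add_cancel]
            _ ≤ _ := by gcongr; exact hB i
      _ ≤ _ := by rw [ENNReal.tsum_mul_left]; gcongr
  calc _ ≤ (B ^ (q - 1) * S) ^ (1 / q) := by gcongr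
    _ = _ := by
      rw [ENNReal.mul_rpow_of_nonneg _ _ (by positivity), ← ENNReal.rpow_mul]
      congr 2
      field_simp

/-- Jensen for the probability weight `w (n - ·)`; then sum over `n`, or bound the weight by its
supremum. -/
lemma ENNReal.convolution_le {G : Type*} [AddCommGroup G] {q : ℝ} (hq : 1 ≤ q)
    {w : G → ℝ≥0∞} (hw : ∑' n, w n = 1) {B : ℝ≥0∞} (hB : ∀ n, w n ≤ B) (g : G → ℝ≥0∞) :
    (∑' n, (∑' k, w (n - k) * g k) ^ q) ^ (1 / q) ≤ (∑' k, g k ^ q) ^ (1 / q) ∧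
      ∀ n, ∑' k, w (n - k) * g k ≤ B ^ (1 / q) * (∑' k, g k ^ q) ^ (1 / q) := by
  have hq0 : 0 < q := by linarith
  have hw1 : ∀ n, ∑' k, w (n - k) ≤ 1 := fun n => by
    rw [← hw, ← (Equiv.subLeft n).tsum_eq w]; rfl
  have key := fun n => ENNReal.tsum_mul_le_rpow_of_tsum_le_one hq (hw1 n) g
  refine ⟨?_, fun n => (key n).trans ?_⟩
  · refine ENNReal.rpow_le_rpow ?_ (by positivity)
    calc _ ≤ ∑' n, ∑' k, w (n - k) * g k ^ q := by
          refine ENNReal.tsum_le_tsum fun n => ?_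
          refine (ENNReal.rpow_le_rpow (key n) hq0.le).trans_eq ?_
          rw [← ENNReal.rpow_mul, one_div_mul_cancel hq0.ne', ENNReal.rpow_one]
      _ = _ := by
          rw [ENNReal.tsum_comm]
          refine tsum_congr fun k => ?_
          have h1 : ∑' n, w (n - k) = 1 := by rw [← hw, ← (Equiv.subRight k).tsum_eq w]; rfl
          rw [ENNReal.tsum_mul_right, h1, one_mul]
  · rw [← ENNReal.mul_rpow_of_nonneg _ _ (by positivity), ← ENNReal.tsum_mul_left]
    gcongr
    exact hB _

end Discrete

lemma ellNorm_eq_tsum {N : ℕ} {q : ℝ≥0∞} (hq : 1 ≤ q) (hq' : q ≠ ∞) (f : (Fin N → ℤ) → ℂ) :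
    ellNorm q f = (∑' k, ‖f k‖ₑ ^ q.toReal) ^ (1 / q.toReal) := by
  rw [ellNorm, eLpNorm_eq_lintegral_rpow_enorm_toReal (by positivity) hq', lintegral_count]

lemma ellNorm_le_interpolate {N : ℕ} {p q : ℝ≥0∞} (hq : 1 ≤ q) (hq' : q ≠ ∞) (hqp : q ≤ p)
    (h : (Fin N → ℤ) → ℂ) {X Y : ℝ≥0∞} (hX : ellNorm q h ≤ X) (hY : ∀ n, ‖h n‖ₑ ≤ Y) :
    ellNorm p h ≤ X ^ (q.toReal / p.toReal) * Y ^ (1 - q.toReal / p.toReal) := by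
  have hq1 : 1 ≤ q.toReal := by
    rw [← ENNReal.toReal_one]; exact ENNReal.toReal_mono hq' hq
  -- With `p = ∞` the convention `∞.toReal = 0` makes the exponents `0` and `1`, so the formula
  -- remains correct.
  rcases eq_or_ne p ∞ with rfl | hp
  · rw [ellNorm, eLpNorm_exponent_top, eLpNormEssSup_count]
    simpa using hY
  have hqp' : q.toReal ≤ p.toReal := ENNReal.toReal_mono hp hqp
  have hp0 : 0 < p.toReal := by linarith
  have hX' : ∑' k, ‖h k‖ₑ ^ q.toReal ≤ X ^ q.toReal := by
    rw [ellNorm_eq_tsum hq hq'] at hX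
    refine le_trans (le_of_eq ?_) (ENNReal.rpow_le_rpow hX (by linarith))
    rw [← ENNReal.rpow_mul, one_div_mul_cancel (by linarith), ENNReal.rpow_one]
  rw [ellNorm_eq_tsum (hq.trans hqp) hp]
  calc _ ≤ (X ^ q.toReal * Y ^ (p.toReal - q.toReal)) ^ (1 / p.toReal) := by
        gcongr
        refine le_trans ?_ (mul_le_mul_left hX' _)
        rw [← ENNReal.tsum_mul_right]
        refine ENNReal.tsum_le_tsum fun k => ?_
        conv_lhs => rw [← add_sub_cancel q.toReal p.toReal]
        rw [ENNReal.rpow_add_of_nonneg _ _ (by linarith) (by linarith)]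
        gcongr
        exact hY k
    _ = _ := by
        rw [ENNReal.mul_rpow_of_nonneg _ _ (by positivity), ← ENNReal.rpow_mul, ← ENNReal.rpow_mul]
        congr 2
        · ring
        · field_simp

/-! ### Assembling the estimate. -/

/-- `ℓ^q` and `ℓ^∞` bounds for functions dominated by the two pieces of the kernel estimate. -/
lemma exists_heatKernel_majorant_bounds {N : ℕ} (hN : 1 ≤ N) {q : ℝ} (hq : 1 ≤ q)
    (hqN : q * ((N : ℝ) - 1) < N) : ∃ K : ℝ, 0 < K ∧ ∀ t : ℝ, 0 < t →
      ∃ Ψ : (Fin N → ℤ) → ℝ, (∀ n, 0 ≤ Ψ n) ∧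
      (∀ n k, |heatKernel t (n - k) - heatKernel t n| ≤
        2 * (latticeAbs k / √t) *
          (heatKernel t (n - k) + Ψ n * diffusiveDecay t (latticeAbs k))) ∧
      ∀ g : (Fin N → ℤ) → ℝ≥0∞, g 0 = 0 →
        (∑' n, (∑' k, ENNReal.ofReal (heatKernel t (n - k)) * g k + ENNReal.ofReal (Ψ n) *
          ∑' k, g k * ENNReal.ofReal (diffusiveDecay t (latticeAbs k))) ^ q) ^ (1 / q) ≤
          ENNReal.ofReal K * (∑' k, g k ^ q) ^ (1 / q) ∧
        ∀ n, ∑' k, ENNReal.ofReal (heatKernel t (n - k)) * g k + ENNReal.ofReal (Ψ n) *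
          ∑' k, g k * ENNReal.ofReal (diffusiveDecay t (latticeAbs k)) ≤
          ENNReal.ofReal (K * √t ^ (-(N : ℝ) / q)) * (∑' k, g k ^ q) ^ (1 / q) := by
  have hq0 : 0 < q := by linarith
  have hq1 : 0 ≤ 1 - 1 / q := by
    rw [sub_nonneg, div_le_one hq0]; exact hq
  obtain ⟨C, hC, H⟩ := exists_abs_heatKernel_sub_le N
  obtain ⟨D, hD, HD⟩ := exists_tsum_mul_diffusiveDecay_le hN hq hqN
  -- The convolution costs `1` in `ℓ^q` and `C^(1/q)` in `ℓ^∞`; the separated term costs `C * D` in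
  -- both.
  refine ⟨1 + C ^ (1 / q) + C * D, by positivity, fun t ht => ?_⟩
  obtain ⟨hG, Ψ, hΨ0, hΨ, hΨsum, hdiff⟩ := H t ht
  refine ⟨Ψ, hΨ0, hdiff, fun g hg => ?_⟩
  have hs : 0 < √t := Real.sqrt_pos.2 ht
  set A := (∑' k, g k ^ q) ^ (1 / q) with hA
  set V := ∑' k, g k * ENNReal.ofReal (diffusiveDecay t (latticeAbs k)) with hV
  have hVle : V ≤ ENNReal.ofReal (D * √t ^ ((N : ℝ) * (1 - 1 / q))) * A := HD t ht g hg
  have hB0 : 0 < C / √t ^ N := by positivity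
  have hBr : ∀ r : ℝ, (C / √t ^ N) ^ r = C ^ r * √t ^ (-(N : ℝ) * r) := by
    intro r
    rw [div_eq_mul_inv, Real.mul_rpow hC.le (by positivity), ← Real.rpow_natCast,
      ← Real.rpow_neg hs.le, ← Real.rpow_mul hs.le]
  obtain ⟨c1, c2⟩ := ENNReal.convolution_le hq (tsum_ofReal_heatKernel N ht)
    (fun n => ENNReal.ofReal_le_ofReal (hG n)) g
  have hCp : 0 < C ^ (1 / q) := by positivity
  have hCD : 0 < C * D := by positivity
  refine ⟨?_, fun n => ?_⟩
  · have hΨq : (∑' n, ENNReal.ofReal (Ψ n) ^ q) ^ (1 / q) ≤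
        ENNReal.ofReal (C * √t ^ (-((N : ℝ) * (1 - 1 / q)))) := by
      refine (ENNReal.tsum_rpow_le_of_le hq (fun n => ENNReal.ofReal_le_ofReal (hΨ n))
        hΨsum).trans_eq ?_
      rw [ENNReal.ofReal_rpow_of_pos hB0, ENNReal.ofReal_rpow_of_pos hC,
        ← ENNReal.ofReal_mul (by positivity), hBr, mul_right_comm, ← Real.rpow_add hC,
        sub_add_cancel, Real.rpow_one, neg_mul]
    calc _ ≤ A + V * (∑' n, ENNReal.ofReal (Ψ n) ^ q) ^ (1 / q) := by
          refine (ENNReal.tsum_add_rpow_le hq _ _).trans (add_le_add c1 ?_)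
          simp only [mul_comm _ V]
          rw [ENNReal.tsum_mul_left_rpow hq0]
      _ ≤ A + (ENNReal.ofReal (D * √t ^ ((N : ℝ) * (1 - 1 / q))) * A) *
            ENNReal.ofReal (C * √t ^ (-((N : ℝ) * (1 - 1 / q)))) := by gcongr
      _ = ENNReal.ofReal (1 + C * D) * A := by
          rw [mul_right_comm, ← ENNReal.ofReal_mul (by positivity),
            ENNReal.ofReal_add zero_le_one (by positivity), ENNReal.ofReal_one, add_mul, one_mul]
          congr 3
          rw [Real.rpow_neg hs.le]
          field_simp
      _ ≤ _ := by gcongr; linarith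
  · calc _ ≤ ENNReal.ofReal (C / √t ^ N) ^ (1 / q) * A + ENNReal.ofReal (C / √t ^ N) *
          (ENNReal.ofReal (D * √t ^ ((N : ℝ) * (1 - 1 / q))) * A) := by
          gcongr
          exacts [c2 n, hΨ n]
      _ = ENNReal.ofReal ((C ^ (1 / q) + C * D) * √t ^ (-(N : ℝ) / q)) * A := by
          rw [ENNReal.ofReal_rpow_of_pos hB0, ← mul_assoc, ← ENNReal.ofReal_mul (by positivity),
            ← add_mul, ← ENNReal.ofReal_add (by positivity) (by positivity), hBr]
          congr 2
          have e : √t ^ (-(N : ℝ) / q) = √t ^ ((N : ℝ) * (1 - 1 / q)) / √t ^ N := by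
            rw [← Real.rpow_natCast (√t) N, ← Real.rpow_sub hs]
            congr 1
            ring
          rw [mul_one_div, e]
          ring
      _ ≤ _ := by gcongr; linarith

lemma Summable.of_tsum_enorm_ne_top {ι E : Type*} [NormedAddCommGroup E] [CompleteSpace E]
    {f : ι → E} (h : ∑' i, ‖f i‖ₑ ≠ ∞) : Summable f :=
  .of_nnnorm (ENNReal.tsum_coe_ne_top_iff_summable.1 h)

/-- Off the origin `|k| v(|k|) ≥ 1/2` at `t = 1`, so the profile sum of `|·|f` controls `∑ |f|`. -/
lemma summable_of_latticeAbs_mul {N : ℕ} (hN : 1 ≤ N) {q : ℝ} (hq : 1 ≤ q)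
    (hqN : q * ((N : ℝ) - 1) < N) {f : (Fin N → ℤ) → ℂ}
    (hf : (∑' k, ‖(latticeAbs k : ℂ) * f k‖ₑ ^ q) ^ (1 / q) ≠ ∞) : Summable f := by
  obtain ⟨D, hD, HD⟩ := exists_tsum_mul_diffusiveDecay_le hN hq hqN
  have h := HD 1 one_pos (fun k => ‖(latticeAbs k : ℂ) * f k‖ₑ) (by simp [latticeAbs])
  have hfin : ∑' k, ‖(latticeAbs k : ℂ) * f k‖ₑ *
      ENNReal.ofReal (diffusiveDecay 1 (latticeAbs k)) ≠ ∞ :=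
    ne_top_of_le_ne_top (ENNReal.mul_ne_top ENNReal.ofReal_ne_top hf) h
  classical
  refine .of_tsum_enorm_ne_top (ne_top_of_le_ne_top (b := ‖f 0‖ₑ + 2 *
    ∑' k, ‖(latticeAbs k : ℂ) * f k‖ₑ * ENNReal.ofReal (diffusiveDecay 1 (latticeAbs k))) ?_ ?_)
  · exact ENNReal.add_ne_top.2 ⟨enorm_ne_top, ENNReal.mul_ne_top ENNReal.ofNat_ne_top hfin⟩
  · rw [← tsum_ite_eq (0 : Fin N → ℤ) fun k => ‖f k‖ₑ, ← ENNReal.tsum_mul_left, ← ENNReal.tsum_add]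
    refine ENNReal.tsum_le_tsum fun k => ?_
    rcases eq_or_ne k 0 with rfl | hk
    · simp
    · have h1 := one_le_latticeAbs hk
      rw [if_neg hk, zero_add, enorm_mul]
      refine le_trans ?_ (le_of_eq (show ‖f k‖ₑ * (2 * (‖(latticeAbs k : ℂ)‖ₑ *
        ENNReal.ofReal (diffusiveDecay 1 (latticeAbs k)))) = _ by ring))
      conv_lhs => rw [← mul_one ‖f k‖ₑ]
      refine mul_le_mul_right ?_ _
      rw [← ofReal_norm (latticeAbs k : ℂ), Complex.norm_real,
        Real.norm_of_nonneg (by linarith), ← ENNReal.ofReal_mul (by linarith),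
        ← ENNReal.ofReal_ofNat 2, ← ENNReal.ofReal_mul (by norm_num), ← ENNReal.ofReal_one]
      refine ENNReal.ofReal_le_ofReal ?_
      rw [diffusiveDecay, Real.sqrt_one, abs_of_nonneg (by linarith), mul_one_div, ← mul_div_assoc,
        one_le_div (by linarith)]
      linarith

lemma mul_natCast_sub_one_lt {N : ℕ} {q : ℝ≥0∞} (hN : 1 ≤ N)
    (hqN : q < (N : ℝ≥0∞) / ((N : ℝ≥0∞) - 1)) : q.toReal * ((N : ℝ) - 1) < N := by
  -- For `N = 1` the bound `1 / 0` is `∞` in `ℝ≥0∞`, in accordance with the intended meaning.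
  rcases hN.eq_or_lt with rfl | hN2
  · simp
  have e : ((N : ℝ≥0∞) - 1) = ((N - 1 : ℕ) : ℝ≥0∞) := by simp
  rw [e, ENNReal.lt_div_iff_mul_lt (.inl (by exact_mod_cast (by lia : N - 1 ≠ 0)))
    (.inl (by simp))] at hqN
  have h := (ENNReal.toReal_lt_toReal hqN.ne_top (by simp)).2 hqN
  rw [ENNReal.toReal_mul, ENNReal.toReal_natCast, ENNReal.toReal_natCast, Nat.cast_sub hN] at h
  simpa using h

theorem mainTheorem1 (N : ℕ) (hN : 1 ≤ N) (p q : ℝ≥0∞) (hq : 1 ≤ q) (hqp : q ≤ p)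
    (hqN : q < (N : ℝ≥0∞) / ((N : ℝ≥0∞) - 1)) :
    ∃ C : ℝ, 0 < C ∧
      ∀ f : (Fin N → ℤ) → ℂ, ellNorm q (fun n => (latticeAbs n : ℂ) * f n) < ∞ →
        Summable f ∧
        ∀ t : ℝ, 0 < t →
          (∀ n : Fin N → ℤ, Summable fun k : Fin N → ℤ => (heatKernel t (n - k) : ℂ) * f k) ∧
          ellNorm p (fun n => heatSemigroup t f n - (∑' k, f k) * (heatKernel t n : ℂ)) ≤
            ENNReal.ofReal
                (C * t ^ (-(1 / 2 : ℝ) - (N : ℝ) / 2 * ((1 / q).toReal - (1 / p).toReal))) *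
              ellNorm q (fun n => (latticeAbs n : ℂ) * f n) := by
  have hq' : q ≠ ∞ := hqN.ne_top
  have hq1 : 1 ≤ q.toReal := by
    rw [← ENNReal.toReal_one]; exact ENNReal.toReal_mono hq' hq
  have hqR := mul_natCast_sub_one_lt hN hqN
  obtain ⟨K, hK, H⟩ := exists_heatKernel_majorant_bounds hN hq1 hqR
  refine ⟨2 * K, by positivity, fun f hf => ?_⟩
  set g : (Fin N → ℤ) → ℂ := fun n => (latticeAbs n : ℂ) * f n with hg
  have hfA := hf.ne
  rw [ellNorm_eq_tsum hq hq'] at hfA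
  have hfs : Summable f := summable_of_latticeAbs_mul hN hq1 hqR hfA
  refine ⟨hfs, fun t ht => ?_⟩
  have hs : 0 < √t := Real.sqrt_pos.2 ht
  have hconv : ∀ n : Fin N → ℤ, Summable fun k : Fin N → ℤ => (heatKernel t (n - k) : ℂ) * f k := by
    intro n
    refine Summable.of_norm_bounded (summable_norm_iff.2 hfs) fun k => ?_
    rw [norm_mul, Complex.norm_real, Real.norm_of_nonneg (heatKernel_nonneg ht _)]
    refine mul_le_of_le_one_left (norm_nonneg _) (ENNReal.ofReal_le_one.1 ?_)
    rw [← tsum_ofReal_heatKernel N ht]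
    exact ENNReal.le_tsum (f := fun n : Fin N → ℤ => ENNReal.ofReal (heatKernel t n)) (n - k)
  refine ⟨hconv, ?_⟩
  obtain ⟨Ψ, hΨ0, hdiff, hbounds⟩ := H t ht
  obtain ⟨b1, b2⟩ := hbounds (fun k => ‖g k‖ₑ) (by simp [hg, latticeAbs])
  rw [← ellNorm_eq_tsum hq hq'] at b1 b2
  set A := ellNorm q g with hA
  set M : (Fin N → ℤ) → ℝ≥0∞ := fun n =>
    ∑' k, ENNReal.ofReal (heatKernel t (n - k)) * ‖g k‖ₑ + ENNReal.ofReal (Ψ n) *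
      ∑' k, ‖g k‖ₑ * ENNReal.ofReal (diffusiveDecay t (latticeAbs k)) with hM
  set h : (Fin N → ℤ) → ℂ :=
    fun n => heatSemigroup t f n - (∑' k, f k) * (heatKernel t n : ℂ) with hh
  have hpt : ∀ n, ‖h n‖ₑ ≤ ENNReal.ofReal (2 / √t) * M n := by
    intro n
    have e : h n = ∑' k, ((heatKernel t (n - k) - heatKernel t n : ℝ) : ℂ) * f k := by
      simp only [hh, heatSemigroup]
      rw [mul_comm (∑' k, f k), ← tsum_mul_left, ← (hconv n).tsum_sub (hfs.mul_left _)]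
      refine tsum_congr fun k => ?_
      push_cast
      ring
    rw [e]
    refine enorm_tsum_le_tsum_enorm.trans ?_
    rw [hM]
    dsimp only
    rw [← ENNReal.tsum_mul_left, ← ENNReal.tsum_add, ← ENNReal.tsum_mul_left]
    refine ENNReal.tsum_le_tsum fun k => ?_
    have hl := latticeAbs_nonneg k
    have hG := heatKernel_nonneg ht (n - k)
    have hu := (diffusiveDecay_pos ht (latticeAbs k)).le
    have eg : ‖g k‖ₑ = ENNReal.ofReal (latticeAbs k) * ‖f k‖ₑ := by
      rw [hg, enorm_mul, ← ofReal_norm (latticeAbs k : ℂ), Complex.norm_real,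
        Real.norm_of_nonneg hl]
    rw [enorm_mul, ← ofReal_norm (Complex.ofReal _), Complex.norm_real, Real.norm_eq_abs]
    calc _ ≤ ENNReal.ofReal (2 * (latticeAbs k / √t) *
          (heatKernel t (n - k) + Ψ n * diffusiveDecay t (latticeAbs k))) * ‖f k‖ₑ := by
          gcongr
          exact hdiff n k
      _ = _ := by
          rw [eg, show 2 * (latticeAbs k / √t) * (heatKernel t (n - k) +
            Ψ n * diffusiveDecay t (latticeAbs k)) = 2 / √t * (latticeAbs k *
              (heatKernel t (n - k) + Ψ n * diffusiveDecay t (latticeAbs k))) by ring,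
            ENNReal.ofReal_mul (by positivity), ENNReal.ofReal_mul hl,
            ENNReal.ofReal_add hG (mul_nonneg (hΨ0 n) hu), ENNReal.ofReal_mul (hΨ0 n)]
          ring
  have hX : ellNorm q h ≤ ENNReal.ofReal (2 / √t * K) * A := by
    rw [ellNorm_eq_tsum hq hq', ENNReal.ofReal_mul (by positivity), mul_assoc]
    refine le_trans ?_ (mul_le_mul_right b1 _)
    rw [← ENNReal.tsum_mul_left_rpow (by linarith)]
    gcongr with n
    exact hpt n
  have hY : ∀ n, ‖h n‖ₑ ≤ ENNReal.ofReal (2 / √t * (K * √t ^ (-(N : ℝ) / q.toReal))) * A := by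
    intro n
    rw [ENNReal.ofReal_mul (by positivity), mul_assoc]
    exact (hpt n).trans (mul_le_mul_right (b2 n) _)
  -- Only the `ℓ^∞` bound carries `√t^(-N/q)`; raised to `1 - q/p`, it becomes `t^(-(N/2)(1/q -
  -- 1/p))`.
  refine (ellNorm_le_interpolate hq hq' hqp h hX hY).trans_eq ?_
  set r := q.toReal / p.toReal with hr
  have hr0 : 0 ≤ r := by positivity
  have hr1 : 0 ≤ 1 - r := by
    rw [sub_nonneg, hr]
    rcases eq_or_ne p ∞ with rfl | hp
    · simp
    · exact div_le_one_of_le₀ (ENNReal.toReal_mono hp hqp) (by positivity)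
  rw [ENNReal.mul_rpow_of_nonneg _ _ hr0, ENNReal.mul_rpow_of_nonneg _ _ hr1, mul_mul_mul_comm,
    ← ENNReal.rpow_add_of_nonneg _ _ hr0 hr1, add_sub_cancel, ENNReal.rpow_one,
    ENNReal.ofReal_rpow_of_pos (by positivity), ENNReal.ofReal_rpow_of_pos (by positivity),
    ← ENNReal.ofReal_mul (by positivity), ← mul_assoc (2 / √t),
    Real.mul_rpow (x := 2 / √t * K) (by positivity) (by positivity), ← mul_assoc,
    ← Real.rpow_add (by positivity), add_sub_cancel, Real.rpow_one, ← Real.rpow_mul hs.le]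
  congr 2
  have e1 : (2 : ℝ) / √t = 2 * √t ^ (-1 : ℝ) := by
    rw [Real.rpow_neg_one]; rfl
  have e2 : ∀ a b : ℝ, 2 * a * K * b = 2 * K * (a * b) := fun a b => by ring
  rw [e1, e2, ← Real.rpow_add hs, Real.sqrt_eq_rpow, ← Real.rpow_mul ht.le]
  congr 2
  rw [ENNReal.toReal_div, ENNReal.toReal_div, ENNReal.toReal_one, hr]
  rcases eq_or_ne p.toReal 0 with hp | hp
  · rw [hp]; simp; ring
  · field_simp
    ring

end
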